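/- **Lemma 2.1 (a nonhyperbolic $\lambda$-lemma).** Write $\mathbb R^n=\mathbb R^s\times\mathbb R^u$, $x=(y,z)$. Let $F:\mathbb R^n\to\mathbb R^n$ be a $C^1$ diffeomorphism with $F(0)=0$ and $DF(0)=\mathrm{diag}(B,C)$, where $|B|<1$, $|B|\,|C^{-1}|<1$, and all eigenvalues of $C$ have modulus $\ge 1$. *Local manifolds.* A local stable manifold $W^s_{loc}$ is the graph $\{(y,g(y)):y\in\Omega\}$ of a $C^1$ map $g$ on an open set $\Omega\ni 0$ of $\mathbb R^s$, with $g(0)=0$, $Dg(0)=0$, such that $F(W^s_{loc})\subset W^s_{loc}$ and, for some $\rho\in(0,1)$, $|F^m(x)|\rho^{-m}\to0$ as $m\to\infty$ for all $x\in W^s_{loc}$. A local center unstable manifold $W^{cu}_{loc}$ is the graph $\{(g(z),z):z\in\Omega\}$ of a $C^1$ map $g$ on an open set $\Omega\ni 0$ of $\mathbb R^u$, with $g(0)=0$, $Dg(0)=0$, that is locally invariant: there is a neighbourhood $O$ of $0$ such that, for $x\in W^{cu}_{loc}\cap O$, each of the points $F(x)$, $F^{-1}(x)$ that lies in $O$ lies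 in $W^{cu}_{loc}$. *Strong conditional instability.* Assume that $0$ is strongly conditionally unstable, i.e. such manifolds $W^s_{loc}$, $W^{cu}_{loc}$ are given for which 1. there are a neighbourhood $U$ of $0$ and a continuous $V:U\to[0,\infty)$ such that $V(x)=0$ if and only if $x\in W^s_{loc}$, and $V(F(x))\ge V(x)$ for all $x\in U\cap F^{-1}(U)$; 2. the fixed point $0$ of $F^{-1}|_{W^{cu}_{loc}}$ is asymptotically stable. Assume also that the coordinates straighten the manifolds: $W^s_{loc}\subset\{z=0\}$ and $W^{cu}_{loc}\subset\{y=0\}$. *Admissible disks.* Let $\varepsilon^y_0,\varepsilon^z_0>0$ be such that on $U_0=\{|y|\le\varepsilon_0^y,\ |z|\le\varepsilon_0^z\}$ the set $W^s_{loc}$ coincides with $\{z=0\}$ and $W^{cu}_{loc}$ with $\{y=0\}$. Let $p=(y_p,0)\in W^s_{loc}$, and let $(y,z')$ be $C^1$ local coordinates on an open neighbourhood of $p$ in which $p$ is $(y_p,0)$ and $W^s_{loc}$ is given by $z'=0$. Let $\varepsilon^y_1,\varepsilon^z_1>0$ be such that the box $U_1=\{|y-y_p|\le\varepsilon_1^y,\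 |z'|\le\varepsilon_1^z\}$ lies in the range of these coordinates. Let $\mathcal D_0$ be the set of all disks $\{(\eta(z),z):|z|\le\varepsilon_0^z\}$ with $\eta$ of class $C^1$, $|\eta|\le\varepsilon_0^y$ and $|D\eta|\le1$ on $|z|\le\varepsilon_0^z$. Let $\mathcal D_1$ be the set of all disks given in the coordinates $(y,z')$ by $\{(\eta(z'),z'):|z'|\le\varepsilon_1^z\}$ with $\eta$ of class $C^1$, $|\eta-y_p|\le\varepsilon_1^y$ and $|D\eta|\le1$ on $|z'|\le\varepsilon^z_1$. Put $\mathcal D=\mathcal D_0\cup\mathcal D_1$. *Conclusion.* There is $\delta>0$ such that the smooth disk $N=\{(0,z):|z|\le\delta\}$ is contained in $W^{cu}_{loc}$ and has the following property. For every $\varepsilon>0$ there is $m(\varepsilon)\in\mathbb N$ such that for every $m\ge m(\varepsilon)$ and every $D\in\mathcal D$ there is a $C^1$ embedding $h_m:N\to\mathbb R^n$ with $h_m(N)\subset F^m(D)$ and $$\mathrm{dist}_1(h_m,\mathrm{id})=\max_N|h_m-\mathrm{id}|+\max_N|D(h_m-\mathrm{id})|<\varepsilon .$$ -/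

import Mathlib

open Set Filter Topology Metric

namespace NonhypLambda

/-- `ℝ^k` with its Euclidean norm. -/
abbrev Euc (k : ℕ) : Type := EuclideanSpace ℝ (Fin k)

/-- `ℝ^n = ℝ^s × ℝ^u`; a point is written `x = (y, z)`, with `y` its stable and `z` its center
unstable component. (The product carries the maximum of the two Euclidean norms, which is
equivalent to the Euclidean norm of `ℝ^n`.) -/
abbrev Phase (s u : ℕ) : Type := Euc s × Euc u

variable {s u : ℕ}

/-- `F` is a `C^1` diffeomorphism of `ℝ^n` with `F 0 = 0` and `DF(0) = diag(B, C)`, where all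
eigenvalues of `B` have modulus `< 1`, all eigenvalues of `C` have modulus `≥ 1`, and the
coordinates are adapted: `|B| < 1` and `|B| < 1 / |C⁻¹|`. (The condition on the eigenvalues of
`B` follows from `|B| < 1`.) -/
structure IsAdaptedDiffeo (F : Phase s u ≃ Phase s u)
    (B : Euc s →L[ℝ] Euc s) (C : Euc u ≃L[ℝ] Euc u) : Prop where
  contDiff : ContDiff ℝ 1 F
  contDiff_symm : ContDiff ℝ 1 F.symm
  map_zero : F 0 = 0
  hasFDerivAt_zero : HasFDerivAt F (B.prodMap (C : Euc u →L[ℝ] Euc u)) 0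
  norm_lt_one : ‖B‖ < 1
  norm_mul_lt_one : ‖B‖ * ‖(C.symm : Euc u →L[ℝ] Euc u)‖ < 1
  one_le_norm_eigenvalue :
    ∀ μ ∈ ((C : Euc u →L[ℝ] Euc u) : Euc u →ₗ[ℝ] Euc u).charpoly.aroots ℂ, 1 ≤ ‖μ‖

/-- `W` is a local stable manifold of the fixed point `0`: the graph of a `C^1` map from a
neighbourhood of `0` in the stable space to the center unstable space, tangent to the stable
space at `0`, mapped into itself by `F`, and such that `|F^m x| ρ^{-m} → 0` on it for some
`ρ < 1`. -/
def IsLocalStableManifold (F : Phase s u ≃ Phase s u) (W : Set (Phase s u)) : Prop :=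
  (∃ (Ω : Set (Euc s)) (g : Euc s → Euc u), IsOpen Ω ∧ 0 ∈ Ω ∧ ContDiffOn ℝ 1 g Ω ∧
      g 0 = 0 ∧ HasFDerivAt g (0 : Euc s →L[ℝ] Euc u) 0 ∧ W = (fun y => (y, g y)) '' Ω) ∧
  MapsTo F W W ∧
  ∃ ρ : ℝ, 0 < ρ ∧ ρ < 1 ∧
    ∀ x ∈ W, Tendsto (fun m : ℕ => ‖F^[m] x‖ * (ρ ^ m)⁻¹) atTop (𝓝 0)

/-- `W` is a local center unstable manifold of the fixed point `0`: the graph of a `C^1` map from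
a neighbourhood of `0` in the center unstable space to the stable space, tangent to the center
unstable space at `0` and locally invariant under `F` and its inverse. -/
def IsLocalCenterUnstableManifold (F : Phase s u ≃ Phase s u) (W : Set (Phase s u)) : Prop :=
  (∃ (Ω : Set (Euc u)) (g : Euc u → Euc s), IsOpen Ω ∧ 0 ∈ Ω ∧ ContDiffOn ℝ 1 g Ω ∧
      g 0 = 0 ∧ HasFDerivAt g (0 : Euc u →L[ℝ] Euc s) 0 ∧ W = (fun z => (g z, z)) '' Ω) ∧
  ∃ O ∈ 𝓝 (0 : Phase s u), ∀ x ∈ W ∩ O,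
    (F x ∈ O → F x ∈ W) ∧ (F.symm x ∈ O → F.symm x ∈ W)

/-- The fixed point `0` of the restriction of `F⁻¹` to `W` is asymptotically stable: it is
Lyapunov stable and attracts all nearby points of `W`. -/
def IsAsymptoticallyStableBackward (F : Phase s u ≃ Phase s u) (W : Set (Phase s u)) : Prop :=
  (∀ ε > 0, ∃ δ > 0, ∀ x ∈ W, ‖x‖ < δ → ∀ k : ℕ, F.symm^[k] x ∈ W ∧ ‖F.symm^[k] x‖ < ε) ∧
  ∃ δ > 0, ∀ x ∈ W, ‖x‖ < δ → Tendsto (fun k : ℕ => F.symm^[k] x) atTop (𝓝 0)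

/-- `0` is a strongly conditionally unstable fixed point of `F`, where `Ws` is the local stable
manifold and `Wcu` is the chosen local center unstable manifold. -/
structure IsStronglyConditionallyUnstable (F : Phase s u ≃ Phase s u)
    (Ws Wcu : Set (Phase s u)) : Prop where
  stable : IsLocalStableManifold F Ws
  centerUnstable : IsLocalCenterUnstableManifold F Wcu
  lyapunov : ∃ U ∈ 𝓝 (0 : Phase s u), ∃ V : Phase s u → ℝ, ContinuousOn V U ∧
    (∀ x ∈ U, 0 ≤ V x) ∧ (∀ x ∈ U, V x = 0 ↔ x ∈ Ws) ∧
    ∀ x ∈ U ∩ F ⁻¹' U, V x ≤ V (F x)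
  asymptoticallyStable : IsAsymptoticallyStableBackward F Wcu

/-- The closed box `{(y, z) : |y - c| ≤ a, |z| ≤ b}`. -/
def box (c : Euc s) (a b : ℝ) : Set (Phase s u) := {x | ‖x.1 - c‖ ≤ a ∧ ‖x.2‖ ≤ b}

/-- The maps `η` defining admissible disks: `C^1` on the closed ball `|z| ≤ b`, with
`|η(z) - c| ≤ a` and `|Dη(z)| ≤ 1` there. -/
structure IsAdmissibleMap (c : Euc s) (a b : ℝ) (η : Euc u → Euc s) : Prop where
  contDiffOn : ContDiffOn ℝ 1 η (closedBall 0 b)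
  norm_sub_le : ∀ z ∈ closedBall (0 : Euc u) b, ‖η z - c‖ ≤ a
  norm_fderivWithin_le : ∀ z ∈ closedBall (0 : Euc u) b,
    ‖fderivWithin ℝ η (closedBall 0 b) z‖ ≤ 1

/-- The disks admissible at the box `|y| ≤ a`, `|z| ≤ b` around the origin. -/
def admissibleDisksAtZero (a b : ℝ) : Set (Set (Phase s u)) :=
  {D | ∃ η : Euc u → Euc s, IsAdmissibleMap 0 a b η ∧ D = (fun z => (η z, z)) '' closedBall 0 b}

/-- `Ψ` is a `C^1` local coordinate system `(y, z')` around the point `p = (y_p, 0)` of `Ws`, in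
which `p` still has the coordinates `(y_p, 0)` and `Ws` is given by `z' = 0`. -/
structure IsStraighteningChart (Ws : Set (Phase s u)) (p : Phase s u)
    (Ψ : OpenPartialHomeomorph (Phase s u) (Phase s u)) : Prop where
  mem_source : p ∈ Ψ.source
  map_p : Ψ p = (p.1, 0)
  contDiffOn : ContDiffOn ℝ 1 Ψ Ψ.source
  contDiffOn_symm : ContDiffOn ℝ 1 Ψ.symm Ψ.target
  mem_iff : ∀ x ∈ Ψ.source, x ∈ Ws ↔ (Ψ x).2 = 0

/-- The disks admissible at the box `|y - y_p| ≤ a`, `|z'| ≤ b` around `p`, in the coordinates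
`(y, z')` given by `Ψ`. -/
def admissibleDisksAt (p : Phase s u) (Ψ : OpenPartialHomeomorph (Phase s u) (Phase s u))
    (a b : ℝ) : Set (Set (Phase s u)) :=
  {D | ∃ η : Euc u → Euc s, IsAdmissibleMap p.1 a b η ∧
    D = (fun z => Ψ.symm (η z, z)) '' closedBall 0 b}

/-- The closed `u`-dimensional disk `{(0, z) : |z| ≤ δ}` in the center unstable space. -/
def centralDisk (s u : ℕ) (δ : ℝ) : Set (Phase s u) := (fun z => (0, z)) '' closedBall (0 : Euc u) δ

/-- `h` is a `C^1` embedding of the disk `{(0, z) : |z| ≤ δ}` into `ℝ^n`. The disk is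
parametrized by `z`; as it is compact, an embedding is the same as an injective immersion. -/
structure IsDiskEmbedding (δ : ℝ) (h : Euc u → Phase s u) : Prop where
  contDiffOn : ContDiffOn ℝ 1 h (closedBall 0 δ)
  injOn : InjOn h (closedBall 0 δ)
  immersion : ∀ z ∈ closedBall (0 : Euc u) δ,
    Function.Injective (fderivWithin ℝ h (closedBall 0 δ) z)

/-- `dist₁(h, id) < ε` on the disk `{(0, z) : |z| ≤ δ}`, parametrized by `z`: the sum of the
maximum of `|h - id|` and of the maximum of `|D(h - id)|` is less than `ε`. In this parametrization
`id` is the inclusion `z ↦ (0, z)`. -/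
def DistOneIdLT (δ : ℝ) (h : Euc u → Phase s u) (ε : ℝ) : Prop :=
  ∃ a b : ℝ, a + b < ε ∧ ∀ z ∈ closedBall (0 : Euc u) δ, ‖h z - (0, z)‖ ≤ a ∧
    ‖fderivWithin ℝ h (closedBall 0 δ) z - ContinuousLinearMap.inr ℝ (Euc s) (Euc u)‖ ≤ b

end NonhypLambda

/-! Near the fixed point the `y`-direction is contracted, but the center direction need not expand,
so the hyperbolic argument is not available. What survives is domination: `‖B‖ * ‖C⁻¹‖ < 1`
preserves cones around the `z`-direction, and one step changes a slope `s` to at most `κ (lam s +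
ω)` with `κ lam < 1`, although `κ ≥ 1` is allowed. Invariance of `{y = 0}` makes `ω` arbitrarily
small near this space, and orbits in the box approach it geometrically. Hence slopes and heights of
iterated graphs tend to zero uniformly (`exists_slope_iterate_le`).

Expansion is replaced by strong conditional instability. An orbit segment starting at distance at
least `r` from the stable manifold keeps `V` bounded below, so it stays away from `{z = 0}`. If it
is long and ends at `|z| ≤ δ`, its end is close to the center unstable disk, and backward attraction
on that disk puts an earlier point close to `0`, a contradiction. Thus long segments ending at `|z|
≤ δ` start near the stable manifold (`exists_norm_snd_lt_of_iterate_mem`), hence away from the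
boundary of the disk, while backward stability keeps them away from `|z| = b`
(`exists_forall_norm_snd_iterate_lt`). The `z`-component of the iterate, restricted to parameters
whose orbits stay in the box, therefore has an image that is open, closed and nonempty in `|z| < δ`.
It is injective, and its inverse parametrizes the required graph (`exists_contDiffOn_rightInverse`).

For disks that start far from `0`, or in other coordinates, compactness gives one number of iterates
and one radius for which the central pieces of all disks become graphs of slope at most one inside
the box (`exists_iterate_cone`). -/

namespace NonhypLambda

/-! ### Domination and cone estimates in a box around the fixed point -/

section Abstract

variable {Y Z : Type*} [NormedAddCommGroup Y] [NormedSpace ℝ Y]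
  [NormedAddCommGroup Z] [NormedSpace ℝ Z]

/-- A tube around a compact subset of a fibre of a product. -/
theorem exists_closedBall_prod_subset {X W : Type*} [PseudoMetricSpace X] [TopologicalSpace W]
    {x : X} {K : Set W} (hK : IsCompact K) {O : Set (X × W)} (hO : IsOpen O)
    (h : ∀ w ∈ K, (x, w) ∈ O) : ∃ r > 0, closedBall x r ×ˢ K ⊆ O := by
  obtain ⟨U, V, hU, -, hxU, hKV, hUV⟩ := generalized_tube_lemma (s := {x}) isCompact_singleton hK hO
    (by rintro ⟨a, w⟩ ⟨ha, hw⟩; obtain rfl : a = x := ha; exact h w hw)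
  obtain ⟨r, hr, hrU⟩ := Metric.isOpen_iff.1 hU x (hxU rfl)
  exact ⟨r / 2, by positivity, fun p hp =>
    hUV ⟨hrU (closedBall_subset_ball (by linarith) hp.1), hKV hp.2⟩⟩

/-- On the box `|y| ≤ a`, `|z| ≤ b` the map `F` contracts the `y`-direction by the factor `lam`,
and preserves the cones around the `z`-direction, both for chords and for tangent vectors. -/
structure IsConeContraction (F : Y × Z → Y × Z) (lam κ ω a b : ℝ) : Prop where
  lam_nonneg : 0 ≤ lam
  lam_lt_one : lam < 1
  κ_pos : 0 < κ
  ω_pos : 0 < ω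
  -- Domination rather than expansion: `κ` is close to `‖C⁻¹‖` and may be at least one.
  κ_mul_lt_one : κ * (lam + ω) < 1
  norm_fst_le : ∀ x ∈ closedBall (0 : Y) a ×ˢ closedBall (0 : Z) b, ‖(F x).1‖ ≤ lam * ‖x.1‖
  snd_eq_zero : ∀ x ∈ closedBall (0 : Y) a ×ˢ closedBall (0 : Z) b, x.2 = 0 → (F x).2 = 0
  expand : ∀ x ∈ closedBall (0 : Y) a ×ˢ closedBall (0 : Z) b,
    ∀ x' ∈ closedBall (0 : Y) a ×ˢ closedBall (0 : Z) b, ‖x.1 - x'.1‖ ≤ ‖x.2 - x'.2‖ →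
      ‖x.2 - x'.2‖ ≤ κ * ‖(F x).2 - (F x').2‖
  slope : ∀ x ∈ closedBall (0 : Y) a ×ˢ closedBall (0 : Z) b,
    ∀ x' ∈ closedBall (0 : Y) a ×ˢ closedBall (0 : Z) b,
      ‖(F x).1 - (F x').1‖ ≤ lam * ‖x.1 - x'.1‖ + ω * ‖x.2 - x'.2‖
  -- Invariance of `{y = 0}` kills the `z`-derivative of the first component there; this field is
  -- what lets slopes tend to zero instead of merely staying bounded.
  slope_small : ∀ ω' > 0, ∃ a' > 0, ∀ x ∈ closedBall (0 : Y) a ×ˢ closedBall (0 : Z) b,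
    ∀ x' ∈ closedBall (0 : Y) a ×ˢ closedBall (0 : Z) b, ‖x'.1‖ ≤ a' →
      ‖(F x).1 - (F x').1‖ ≤ lam * ‖x.1 - x'.1‖ + ω' * ‖x.2 - x'.2‖
  tangent_slope : ∀ x ∈ closedBall (0 : Y) a ×ˢ closedBall (0 : Z) b, ∀ v w,
    ‖(fderiv ℝ F x (v, w)).1‖ ≤ lam * ‖v‖ + ω * ‖w‖
  -- No cone condition on `(v, w)`: along the invariant space `{z = 0}`, `v` does not contribute to
  -- the second component. Arbitrarily steep tangent vectors are therefore admitted.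
  tangent_expand : ∀ y ∈ ball (0 : Y) a, ∀ v w, ‖w‖ ≤ κ * ‖(fderiv ℝ F (y, 0) (v, w)).2‖

theorem IsConeContraction.mono {F : Y × Z → Y × Z} {lam κ ω a a' b : ℝ}
    (h : IsConeContraction F lam κ ω a b) (ha : a' ≤ a) : IsConeContraction F lam κ ω a' b := by
  have hsub : closedBall (0 : Y) a' ×ˢ closedBall (0 : Z) b ⊆ closedBall 0 a ×ˢ closedBall 0 b :=
    prod_mono (closedBall_subset_closedBall ha) subset_rfl
  exact
    { lam_nonneg := h.lam_nonneg
      lam_lt_one := h.lam_lt_one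
      κ_pos := h.κ_pos
      ω_pos := h.ω_pos
      κ_mul_lt_one := h.κ_mul_lt_one
      norm_fst_le := fun x hx => h.norm_fst_le x (hsub hx)
      snd_eq_zero := fun x hx => h.snd_eq_zero x (hsub hx)
      expand := fun x hx x' hx' => h.expand x (hsub hx) x' (hsub hx')
      slope := fun x hx x' hx' => h.slope x (hsub hx) x' (hsub hx')
      slope_small := fun w hw => by
        obtain ⟨c, hc, H⟩ := h.slope_small w hw
        exact ⟨c, hc, fun x hx x' hx' => H x (hsub hx) x' (hsub hx')⟩
      tangent_slope := fun x hx => h.tangent_slope x (hsub hx)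
      tangent_expand := fun y hy => h.tangent_expand y (ball_subset_ball ha hy) }

/-- If `(F (0, z)).1` vanishes for small `z`, the variation of `(F (y, z)).1` in the `z`-direction
is small for small `y`. -/
theorem exists_norm_fst_sub_le [FiniteDimensional ℝ Z] {F : Y × Z → Y × Z} (hF : ContDiff ℝ 1 F) {b R : ℝ} (hbR : b < R)
    (hu : ∀ z ∈ ball (0 : Z) R, (F (0, z)).1 = 0) {ω : ℝ} (hω : 0 < ω) :
    ∃ a > 0, ∀ y ∈ closedBall (0 : Y) a, ∀ z ∈ closedBall (0 : Z) b, ∀ z' ∈ closedBall (0 : Z) b,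
      ‖(F (y, z)).1 - (F (y, z')).1‖ ≤ ω * ‖z - z'‖ := by
  have hder : ∀ x : Y × Z, HasFDerivAt (fun z => (F (x.1, z)).1)
      ((ContinuousLinearMap.fst ℝ Y Z).comp
        ((fderiv ℝ F x).comp (ContinuousLinearMap.inr ℝ Y Z))) x.2 := by
    intro x
    have h1 : HasFDerivAt F (fderiv ℝ F x) (x.1, x.2) :=
      (hF.differentiable one_ne_zero x).hasFDerivAt
    exact hasFDerivAt_fst.comp x.2 (h1.comp x.2 (hasFDerivAt_prodMk_right x.1 x.2))
  set L : Y × Z → Z →L[ℝ] Y := fun x => (ContinuousLinearMap.fst ℝ Y Z).comp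
        ((fderiv ℝ F x).comp (ContinuousLinearMap.inr ℝ Y Z)) with hL
  have hLc : Continuous L :=
    continuous_const.clm_comp ((hF.continuous_fderiv one_ne_zero).clm_comp continuous_const)
  obtain ⟨a, ha, H⟩ := exists_closedBall_prod_subset (x := (0 : Y)) (isCompact_closedBall (0 : Z) b)
    (O := {x | ‖L x‖ < ω}) (isOpen_lt hLc.norm continuous_const) (by
      intro z hz
      have hz' : ball (0 : Z) R ∈ 𝓝 z :=
        isOpen_ball.mem_nhds (closedBall_subset_ball hbR hz)
      have h0 : HasFDerivAt (fun z => (F ((0 : Y), z)).1) (0 : Z →L[ℝ] Y) z :=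
        (hasFDerivAt_const (0 : Y) z).congr_of_eventuallyEq
          (by filter_upwards [hz'] with w hw using hu w hw)
      have : L (0, z) = 0 := (hder (0, z)).unique h0
      simp [this, hω])
  refine ⟨a, ha, fun y hy z hz z' hz' => ?_⟩
  exact (convex_closedBall (0 : Z) b).norm_image_sub_le_of_norm_hasFDerivWithin_le
    (f := fun z => (F (y, z)).1) (f' := fun z => L (y, z))
    (fun w _ => (hder (y, w)).hasFDerivWithinAt)
    (fun w hw => (H (show (y, w) ∈ _ from ⟨hy, hw⟩) : ‖L (y, w)‖ < ω).le) hz' hz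

/-- All constants are perturbations of those of `diag(B, C)`, and the inequalities between them are
strict, so they survive on a small box by continuity of `DF`. The bound on `a` is chosen after `b`,
because the tube around `{y = 0}` depends on `b`. -/
theorem exists_isConeContraction [FiniteDimensional ℝ Z] {F : Y × Z → Y × Z} (hF : ContDiff ℝ 1 F)
    {B : Y →L[ℝ] Y} {C : Z ≃L[ℝ] Z}
    (hA : HasFDerivAt F (B.prodMap (C : Z →L[ℝ] Z)) 0) (hB : ‖B‖ < 1)
    (hBC : ‖B‖ * ‖(C.symm : Z →L[ℝ] Z)‖ < 1)
    (hs : ∀ᶠ y in 𝓝 (0 : Y), (F (y, 0)).2 = 0) (hu : ∀ᶠ z in 𝓝 (0 : Z), (F (0, z)).1 = 0) :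
    ∃ lam κ ω R : ℝ, 0 < R ∧ ∀ b < R, ∃ a₀ > 0, ∀ a ≤ a₀,
      IsConeContraction F lam κ ω a b := by
  set Ci : Z →L[ℝ] Z := (C.symm : Z →L[ℝ] Z) with hCi
  -- the constants
  obtain ⟨ε, hε, h1, h2, h3⟩ : ∃ ε : ℝ, 0 < ε ∧ ‖B‖ + ε < 1 ∧ ‖Ci‖ * ε < 1 ∧
      (‖Ci‖ + ε) / (1 - ‖Ci‖ * ε) * (‖B‖ + ε + ε) < 1 := by
    have e1 : ∀ᶠ ε : ℝ in 𝓝 0, ‖B‖ + ε < 1 :=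
      ContinuousAt.eventually_lt (by fun_prop) continuousAt_const (by simpa using hB)
    have e2 : ∀ᶠ ε : ℝ in 𝓝 0, ‖Ci‖ * ε < 1 :=
      ContinuousAt.eventually_lt (by fun_prop) continuousAt_const (by simp)
    have e3 : ∀ᶠ ε : ℝ in 𝓝 0, (‖Ci‖ + ε) / (1 - ‖Ci‖ * ε) * (‖B‖ + ε + ε) < 1 := by
      refine ContinuousAt.eventually_lt ?_ continuousAt_const (by simpa [mul_comm] using hBC)
      refine ContinuousAt.mul (ContinuousAt.div (by fun_prop) (by fun_prop) (by simp)) (by fun_prop)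
    have e := ((e1.and (e2.and e3)).filter_mono (nhdsWithin_le_nhds (s := Ioi 0))).and
      self_mem_nhdsWithin
    obtain ⟨ε, ⟨a, b, c⟩, d⟩ := e.exists
    exact ⟨ε, d, a, b, c⟩
  set A := B.prodMap (C : Z →L[ℝ] Z) with hAdef
  have hA0 : fderiv ℝ F 0 = A := hA.fderiv
  -- the neighbourhood where `DF` is almost constant
  obtain ⟨R₁, hR₁, hR₁'⟩ : ∃ R > 0, ∀ x ∈ ball (0 : Y × Z) R, ‖fderiv ℝ F x - A‖ < ε := by
    have hc : ContinuousAt (fun x => ‖fderiv ℝ F x - A‖) 0 :=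
      ((hF.continuous_fderiv one_ne_zero).sub continuous_const).norm.continuousAt
    have := hc.eventually_lt (continuousAt_const (y := ε)) (by simpa [hA0] using hε)
    exact Metric.eventually_nhds_iff_ball.1 this
  obtain ⟨R₂, hR₂, hs'⟩ := Metric.eventually_nhds_iff_ball.1 hs
  obtain ⟨R₃, hR₃, hu'⟩ := Metric.eventually_nhds_iff_ball.1 hu
  have hchord : ∀ x ∈ ball (0 : Y × Z) R₁, ∀ x' ∈ ball (0 : Y × Z) R₁,
      ‖F x - F x' - A (x - x')‖ ≤ ε * ‖x - x'‖ := fun x hx x' hx' =>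
    (convex_ball (0 : Y × Z) R₁).norm_image_sub_le_of_norm_hasFDerivWithin_le'
      (f' := fderiv ℝ F)
      (fun w _ => (hF.differentiable one_ne_zero w).hasFDerivAt.hasFDerivWithinAt)
      (fun w hw => (hR₁' w hw).le) hx' hx
  have hden : 0 < 1 - ‖Ci‖ * ε := by linarith
  have hCiC : ∀ w : Z, ‖w‖ ≤ ‖Ci‖ * ‖C w‖ := fun w => by
    have := Ci.le_opNorm (C w)
    simpa [hCi] using this
  -- solving for `‖w‖`
  have hsolve : ∀ (w t : Z), ‖t - C w‖ ≤ ε * ‖w‖ →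
      ‖w‖ ≤ (‖Ci‖ + ε) / (1 - ‖Ci‖ * ε) * ‖t‖ := fun w t h => by
    rw [div_mul_eq_mul_div, le_div_iff₀ hden]
    have h4 : ‖C w‖ ≤ ‖t‖ + ε * ‖w‖ := by
      have := norm_sub_le t (t - C w)
      simp only [sub_sub_cancel] at this
      linarith
    have h5 := hCiC w
    have h6 := mul_le_mul_of_nonneg_left h4 (norm_nonneg Ci)
    nlinarith [norm_nonneg t, mul_nonneg hε.le (norm_nonneg t)]
  -- The `ε` in the numerator of `κ` only serves to keep `κ` positive when `Z` is trivial.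
  refine ⟨‖B‖ + ε, (‖Ci‖ + ε) / (1 - ‖Ci‖ * ε), ε, min R₁ R₃, lt_min hR₁ hR₃, fun b hb => ?_⟩
  have hbR₁ : b < R₁ := hb.trans_le (min_le_left _ _)
  have hbR₃ : b < R₃ := hb.trans_le (min_le_right _ _)
  obtain ⟨a₁, ha₁, H₁⟩ := exists_norm_fst_sub_le hF hbR₃ hu' hε
  refine ⟨min a₁ (min (R₁ / 2) (R₂ / 2)), by positivity, fun a ha => ?_⟩
  have haa₁ : a ≤ a₁ := ha.trans (min_le_left _ _)
  have haR₁ : a < R₁ := by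
    have : a ≤ R₁ / 2 := ha.trans ((min_le_right _ _).trans (min_le_left _ _))
    linarith
  have haR₂ : a < R₂ := by
    have : a ≤ R₂ / 2 := ha.trans ((min_le_right _ _).trans (min_le_right _ _))
    linarith
  have hball : closedBall (0 : Y) a ×ˢ closedBall (0 : Z) b ⊆ ball (0 : Y × Z) R₁ := by
    rintro ⟨y, z⟩ ⟨hy, hz⟩
    simp only [mem_closedBall, dist_zero_right] at hy hz
    rw [mem_ball, dist_zero_right, Prod.norm_def, max_lt_iff]
    exact ⟨hy.trans_lt haR₁, hz.trans_lt hbR₁⟩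
  have hκ : 0 < (‖Ci‖ + ε) / (1 - ‖Ci‖ * ε) := by positivity
  -- the variation in the `y`-direction
  have hvary : ∀ y ∈ closedBall (0 : Y) a, ∀ y' ∈ closedBall (0 : Y) a,
      ∀ z ∈ closedBall (0 : Z) b,
      ‖(F (y, z)).1 - (F (y', z)).1‖ ≤ (‖B‖ + ε) * ‖y - y'‖ := by
    intro y hy y' hy' z hz
    have h := hchord (y, z) (hball ⟨hy, hz⟩) (y', z) (hball ⟨hy', hz⟩)
    have h' := (norm_fst_le _).trans h
    have h3 : ‖(F (y, z)).1 - (F (y', z)).1 - B (y - y')‖ ≤ ε * ‖y - y'‖ := by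
      simpa [hAdef, Prod.norm_mk] using h'
    have h'' := norm_sub_norm_le ((F (y, z)).1 - (F (y', z)).1) (B (y - y'))
    have := B.le_opNorm (y - y')
    linarith
  have hslope : ∀ ω' a', a' ≤ a → (∀ y ∈ closedBall (0 : Y) a', ∀ z ∈ closedBall (0 : Z) b,
      ∀ z' ∈ closedBall (0 : Z) b, ‖(F (y, z)).1 - (F (y, z')).1‖ ≤ ω' * ‖z - z'‖) →
      ∀ x ∈ closedBall (0 : Y) a ×ˢ closedBall (0 : Z) b,
      ∀ x' ∈ closedBall (0 : Y) a ×ˢ closedBall (0 : Z) b, ‖x'.1‖ ≤ a' →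
      ‖(F x).1 - (F x').1‖ ≤ (‖B‖ + ε) * ‖x.1 - x'.1‖ + ω' * ‖x.2 - x'.2‖ := by
    rintro ω' a' - H ⟨y, z⟩ ⟨hy, hz⟩ ⟨y', z'⟩ ⟨hy', hz'⟩ hle
    -- The chord is split at `(y', z)`, so the `z`-variation is measured at `y'` alone; hence only
    -- `x'` has to be close to `{y = 0}`.
    have e1 := hvary y hy y' hy' z hz
    have e2 := H y' (by simpa using hle) z hz z' hz'
    calc ‖(F (y, z)).1 - (F (y', z')).1‖
        ≤ ‖(F (y, z)).1 - (F (y', z)).1‖ + ‖(F (y', z)).1 - (F (y', z')).1‖ :=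
          norm_sub_le_norm_sub_add_norm_sub ..
      _ ≤ _ := add_le_add e1 e2
  exact
    { lam_nonneg := by positivity
      lam_lt_one := h1
      κ_pos := hκ
      ω_pos := hε
      κ_mul_lt_one := h3
      norm_fst_le := by
        rintro ⟨y, z⟩ ⟨hy, hz⟩
        have ha0 : 0 ≤ a := (norm_nonneg y).trans (by simpa using hy)
        have := hvary y hy 0 (by simpa using ha0) z hz
        rwa [hu' z (closedBall_subset_ball hbR₃ hz), sub_zero, sub_zero] at this
      snd_eq_zero := by
        rintro ⟨y, z⟩ ⟨hy, hz⟩ (rfl : z = 0)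
        exact hs' y (closedBall_subset_ball haR₂ hy)
      expand := by
        intro x hx x' hx' hle
        have h := (norm_snd_le _).trans (hchord x (hball hx) x' (hball hx'))
        refine hsolve _ _ ?_
        rw [Prod.norm_def (x := x - x'), Prod.fst_sub, Prod.snd_sub x, max_eq_right hle] at h
        simpa [hAdef] using h
      slope := by
        intro x hx x' hx'
        refine hslope ε a le_rfl (fun y hy => H₁ y (closedBall_subset_closedBall haa₁ hy)) x hx x' hx' ?_
        simpa using hx'.1
      slope_small := by
        intro ω' hω'
        obtain ⟨a₂, ha₂, H₂⟩ := exists_norm_fst_sub_le hF hbR₃ hu' hω'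
        refine ⟨a₂, ha₂, fun x hx x' hx' hle => ?_⟩
        refine hslope ω' (min a a₂) (min_le_left _ _) (fun y hy => H₂ y
          (closedBall_subset_closedBall (min_le_right _ _) hy)) x hx x' hx' (le_min ?_ hle)
        simpa using hx'.1
      tangent_slope := by
        intro x hx v w
        have h := (fderiv ℝ F x - A).le_of_opNorm_le (hR₁' x (hball hx)).le (v, w)
        have h' := (norm_fst_le _).trans h
        have hm : ‖(v, w)‖ ≤ ‖v‖ + ‖w‖ := by
          rw [Prod.norm_mk]; exact max_le_add_of_nonneg (norm_nonneg _) (norm_nonneg _)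
        have h'' := norm_sub_norm_le (fderiv ℝ F x (v, w)).1 (B v)
        have := B.le_opNorm v
        have h3 : ‖(fderiv ℝ F x (v, w)).1 - B v‖ ≤ ε * ‖(v, w)‖ := by simpa [hAdef] using h'
        nlinarith
      tangent_expand := by
        intro y hy v w
        have hya := ball_subset_closedBall hy
        have hd : HasFDerivAt F (fderiv ℝ F (y, 0)) (y, 0) :=
          (hF.differentiable one_ne_zero _).hasFDerivAt
        have h0 : (fderiv ℝ F (y, 0) (v, 0)).2 = 0 := by
          have e1 : HasFDerivAt (fun y => (F (y, (0 : Z))).2) ((ContinuousLinearMap.snd ℝ Y Z).comp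
              ((fderiv ℝ F (y, 0)).comp (ContinuousLinearMap.inl ℝ Y Z))) y :=
            hasFDerivAt_snd.comp y (HasFDerivAt.comp (f := fun y => (y, (0 : Z))) y hd
              (hasFDerivAt_prodMk_left y (0 : Z)))
          have e2 : HasFDerivAt (fun y => (F (y, (0 : Z))).2) (0 : Y →L[ℝ] Z) y :=
            (hasFDerivAt_const (0 : Z) y).congr_of_eventuallyEq (by
              filter_upwards [isOpen_ball.mem_nhds hy] with y' hy'
              exact hs' y' (ball_subset_ball haR₂.le hy'))
          have := congrArg (fun T => T v) (e1.unique e2)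
          simpa using this
        have h1 : (fderiv ℝ F (y, 0) (v, w)).2 = (fderiv ℝ F (y, 0) (0, w)).2 := by
          have : ((v, w) : Y × Z) = (v, 0) + (0, w) := by simp
          rw [this, map_add, Prod.snd_add, h0, zero_add]
        refine hsolve _ _ ?_
        rw [h1]
        have ha0 : 0 ≤ a := (norm_nonneg y).trans (by simpa using hya)
        have hy0 : ((y, 0) : Y × Z) ∈ ball (0 : Y × Z) R₁ := by
          rw [mem_ball, dist_zero_right, Prod.norm_def, max_lt_iff]
          exact ⟨(by simpa using hya : ‖y‖ ≤ a).trans_lt haR₁, by simpa using hR₁⟩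
        have h := (fderiv ℝ F (y, 0) - A).le_of_opNorm_le (hR₁' _ hy0).le (0, w)
        have h' := (norm_snd_le _).trans h
        simpa [hAdef, Prod.norm_mk] using h' }

end Abstract

/-! ### Orbit segments in the box: cones, slopes and backward attraction -/

section Dynamics

variable {Y Z : Type*} [NormedAddCommGroup Y] [NormedSpace ℝ Y]
  [NormedAddCommGroup Z] [NormedSpace ℝ Z]

/-- Attraction to a stable fixed point is uniform on compact sets. -/
theorem exists_forall_norm_iterate_lt {X : Type*} [SeminormedAddCommGroup X] {H : X → X}
    (hH : Continuous H) {W K : Set X}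
    (hst : ∀ ε > 0, ∃ δ > 0, ∀ x ∈ W, ‖x‖ < δ → ∀ k : ℕ, ‖H^[k] x‖ < ε)
    (hK : IsCompact K) (hKW : ∀ x ∈ K, ∀ k, H^[k] x ∈ W)
    (hlim : ∀ x ∈ K, Tendsto (fun k : ℕ => H^[k] x) atTop (𝓝 0)) {τ : ℝ} (hτ : 0 < τ) :
    ∃ M, ∀ k ≥ M, ∀ x ∈ K, ‖H^[k] x‖ < τ := by
  obtain ⟨δ, hδ, hδ'⟩ := hst τ hτ
  -- The repeated membership in `K` allows compactness induction over sets not contained in `K`.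
  suffices h : ∃ M, ∀ k ≥ M, ∀ x ∈ K, x ∈ K → ‖H^[k] x‖ < τ by
    obtain ⟨M, hM⟩ := h
    exact ⟨M, fun k hk x hx => hM k hk x hx hx⟩
  refine hK.induction_on (p := fun s => ∃ M, ∀ k ≥ M, ∀ x ∈ s, x ∈ K → ‖H^[k] x‖ < τ)
    ⟨0, by simp⟩ ?_ ?_ ?_
  · rintro s t hst ⟨M, hM⟩
    exact ⟨M, fun k hk x hx => hM k hk x (hst hx)⟩
  · rintro s t ⟨M, hM⟩ ⟨M', hM'⟩
    refine ⟨max M M', fun k hk x hx => ?_⟩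
    rcases hx with hx | hx
    · exact hM k ((le_max_left _ _).trans hk) x hx
    · exact hM' k ((le_max_right _ _).trans hk) x hx
  · intro x hx
    -- One entry into the stability ball suffices: nearby points enter at the same time, and
    -- stability controls all later times.
    have h1 : ∀ᶠ k in atTop, ‖H^[k] x‖ < δ := by
      have := (hlim x hx).norm
      rw [norm_zero] at this
      exact this.eventually_lt_const hδ
    obtain ⟨n, hn⟩ := h1.exists
    refine ⟨{x' | ‖H^[n] x'‖ < δ}, mem_nhdsWithin_of_mem_nhds
      ((isOpen_lt (hH.iterate n).norm continuous_const).mem_nhds hn), n, ?_⟩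
    intro k hk x' hx' hx'K
    have := hδ' _ (hKW x' hx'K n) hx' (k - n)
    rwa [← Function.iterate_add_apply, Nat.sub_add_cancel hk] at this

/-- Backward orbits of points close to the centre unstable disk `|z| ≤ δ` follow those of the disk,
as long as they stay close to the centre unstable space. -/
theorem exists_forall_norm_snd_iterate_lt {X : Type*} [SeminormedAddCommGroup X]
    [FiniteDimensional ℝ Z] {F H : X × Z → X × Z}
    (hH : Continuous H) (hHF : Function.LeftInverse H F) {δ b : ℝ} {M : ℕ} (hM : 1 ≤ M)
    (h1 : ∀ k, ∀ z ∈ closedBall (0 : Z) δ, ‖H^[k] (0, z)‖ < b)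
    (h2 : ∀ z ∈ closedBall (0 : Z) δ, ‖H^[M] (0, z)‖ < δ) :
    ∃ a > 0, ∀ m x, (∀ j ≤ m, ‖(F^[j] x).1‖ ≤ a) → ‖(F^[m] x).2‖ ≤ δ →
      ∀ j ≤ m, ‖(F^[j] x).2‖ < b := by
  obtain ⟨a, ha, Ha⟩ := exists_closedBall_prod_subset (x := (0 : X))
    (isCompact_closedBall (0 : Z) δ)
    (O := (⋂ i ∈ Finset.range (M + 1), {p | ‖H^[i] p‖ < b}) ∩ {p | ‖H^[M] p‖ < δ})
    ((isOpen_biInter_finset fun i _ => isOpen_lt (hH.iterate i).norm continuous_const).inter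
      (isOpen_lt (hH.iterate M).norm continuous_const))
    (fun z hz => ⟨mem_iInter₂.2 fun i _ => h1 i z hz, h2 z hz⟩)
  have hback : ∀ x i j, H^[i] (F^[i + j] x) = F^[j] x := fun x i j => by
    rw [Function.iterate_add_apply]
    exact hHF.iterate i _
  -- The tube controls the last `M` steps, and `M` steps back the orbit is again at `|z| ≤ δ`, so
  -- the argument restarts there; `1 ≤ M` makes the induction descend.
  refine ⟨a, ha, fun m => ?_⟩
  induction m using Nat.strong_induction_on with
  | _ m ih =>
    intro x hx hm j hj
    have hmem : F^[m] x ∈ closedBall (0 : X) a ×ˢ closedBall (0 : Z) δ :=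
      ⟨by simpa using hx m le_rfl, by simpa using hm⟩
    obtain ⟨hA, hB⟩ := Ha hmem
    rcases le_total (m - j) M with h | h
    · have := mem_iInter₂.1 hA (m - j) (Finset.mem_range.2 (by omega))
      have e : H^[m - j] (F^[m] x) = F^[j] x := by
        have := hback x (m - j) j
        rwa [Nat.sub_add_cancel hj] at this
      rw [mem_ofPred_eq, e] at this
      exact (norm_snd_le _).trans_lt this
    · refine ih (m - M) (by omega) x (fun i hi => hx i (by omega)) ?_ j (by omega)
      have e : H^[M] (F^[m] x) = F^[m - M] x := by
        have := hback x M (m - M)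
        rwa [Nat.add_sub_cancel' (by omega)] at this
      rw [mem_ofPred_eq, e] at hB
      exact ((norm_snd_le _).trans_lt hB).le

namespace IsConeContraction

variable {F : Y × Z → Y × Z} {lam κ ω a b : ℝ}

theorem norm_fst_iterate_le (hF : IsConeContraction F lam κ ω a b) {x : Y × Z} {m : ℕ}
    (hx : ∀ j < m, F^[j] x ∈ closedBall (0 : Y) a ×ˢ closedBall (0 : Z) b) :
    ‖(F^[m] x).1‖ ≤ lam ^ m * ‖x.1‖ := by
  induction m with
  | zero => simp
  | succ m ih =>
    rw [Function.iterate_succ_apply', pow_succ', mul_assoc]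
    exact (hF.norm_fst_le _ (hx m (by omega))).trans
      (mul_le_mul_of_nonneg_left (ih fun j hj => hx j (by omega)) hF.lam_nonneg)

/-- For a chord in the cone, `expand` and `slope` combine to bound the new `y`-difference by `κ (lam
+ ω) < 1` times the new `z`-difference. The factor `κ ^ m` may grow, but it still gives injectivity
in the `z`-component. -/
theorem cone_iterate (hF : IsConeContraction F lam κ ω a b) {x x' : Y × Z} {m : ℕ}
    (hx : ∀ j < m, F^[j] x ∈ closedBall (0 : Y) a ×ˢ closedBall (0 : Z) b)
    (hx' : ∀ j < m, F^[j] x' ∈ closedBall (0 : Y) a ×ˢ closedBall (0 : Z) b)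
    (h : ‖x.1 - x'.1‖ ≤ ‖x.2 - x'.2‖) :
    ‖(F^[m] x).1 - (F^[m] x').1‖ ≤ ‖(F^[m] x).2 - (F^[m] x').2‖ ∧
      ‖x.2 - x'.2‖ ≤ κ ^ m * ‖(F^[m] x).2 - (F^[m] x').2‖ := by
  induction m with
  | zero => simpa using h
  | succ m ih =>
    obtain ⟨i1, i2⟩ := ih (fun j hj => hx j (by omega)) (fun j hj => hx' j (by omega))
    have e1 := hF.expand _ (hx m (by omega)) _ (hx' m (by omega)) i1
    have e2 := hF.slope _ (hx m (by omega)) _ (hx' m (by omega))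
    simp only [Function.iterate_succ_apply']
    have hl := hF.lam_nonneg
    have hw := hF.ω_pos
    constructor
    · calc _ ≤ _ := e2
        _ ≤ (lam + ω) * ‖(F^[m] x).2 - (F^[m] x').2‖ := by nlinarith
        _ ≤ (lam + ω) * (κ * ‖(F (F^[m] x)).2 - (F (F^[m] x')).2‖) := by gcongr
        _ = κ * (lam + ω) * ‖(F (F^[m] x)).2 - (F (F^[m] x')).2‖ := by ring
        _ ≤ _ := mul_le_of_le_one_left (norm_nonneg _) hF.κ_mul_lt_one.le
    · refine i2.trans ?_
      rw [pow_succ, mul_assoc]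
      exact mul_le_mul_of_nonneg_left e1 (pow_nonneg hF.κ_pos.le _)

/-- Slopes satisfy an affine recursion with rate `κ lam < 1`, whose inhomogeneous term becomes as
small as desired once the orbits are close to `{y = 0}`. The number of steps is independent of the
orbits. -/
theorem exists_slope_iterate_le (hF : IsConeContraction F lam κ ω a b) {s : ℝ} (hs : 0 < s) :
    ∃ n, ∀ m ≥ n, ∀ x x' : Y × Z,
      (∀ j < m, F^[j] x ∈ closedBall (0 : Y) a ×ˢ closedBall (0 : Z) b) →
      (∀ j < m, F^[j] x' ∈ closedBall (0 : Y) a ×ˢ closedBall (0 : Z) b) →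
      ‖x.1 - x'.1‖ ≤ ‖x.2 - x'.2‖ →
      ‖(F^[m] x).1 - (F^[m] x').1‖ ≤ s * ‖(F^[m] x).2 - (F^[m] x').2‖ := by
  have hl := hF.lam_nonneg
  have hκ := hF.κ_pos
  have hθ : κ * lam < 1 := by nlinarith [hF.κ_mul_lt_one, hF.ω_pos]
  have hθ0 : 0 ≤ κ * lam := by positivity
  -- With this value of `ω'`, `s / 2` is the fixed point of `t ↦ κ (lam t + ω')`.
  obtain ⟨a', ha', Ha'⟩ := hF.slope_small ((1 - κ * lam) * (s / 2) / κ)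
    (by have : 0 < 1 - κ * lam := by linarith
        positivity)
  obtain ⟨J, hJ⟩ : ∃ J : ℕ, ∀ j ≥ J, lam ^ j * a ≤ a' := by
    have : Tendsto (fun j : ℕ => lam ^ j * a) atTop (𝓝 0) := by
      simpa using (tendsto_pow_atTop_nhds_zero_of_lt_one hl hF.lam_lt_one).mul_const a
    exact eventually_atTop.1 (this.eventually_le_const ha')
  obtain ⟨i, hi⟩ := exists_pow_lt_of_lt_one (half_pos hs) hθ
  refine ⟨J + i, fun m hm x x' hx hx' h => ?_⟩
  have key : ∀ n, J + n ≤ m → ‖(F^[J + n] x).1 - (F^[J + n] x').1‖ ≤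
      ((κ * lam) ^ n + s / 2) * ‖(F^[J + n] x).2 - (F^[J + n] x').2‖ := by
    intro n
    induction n with
    | zero =>
      intro hn
      have := (hF.cone_iterate (m := J) (fun j hj => hx j (by omega))
        (fun j hj => hx' j (by omega)) h).1
      simp only [add_zero, pow_zero]
      nlinarith [norm_nonneg ((F^[J] x).2 - (F^[J] x').2)]
    | succ n ih =>
      intro hn
      have i1 := ih (by omega)
      have hcone := (hF.cone_iterate (m := J + n) (fun j hj => hx j (by omega))
        (fun j hj => hx' j (by omega)) h).1
      have e1 := hF.expand _ (hx (J + n) (by omega)) _ (hx' (J + n) (by omega)) hcone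
      have hsm : ‖(F^[J + n] x').1‖ ≤ a' := by
        refine (hF.norm_fst_iterate_le fun j hj => hx' j (by omega)).trans
          (le_trans ?_ (hJ (J + n) (by omega)))
        have : ‖x'.1‖ ≤ a := by simpa using (hx' 0 (by omega)).1
        gcongr
      have e2 := Ha' _ (hx (J + n) (by omega)) _ (hx' (J + n) (by omega)) hsm
      rw [← add_assoc]
      simp only [Function.iterate_succ_apply']
      calc _ ≤ _ := e2
        _ ≤ lam * (((κ * lam) ^ n + s / 2) * ‖(F^[J + n] x).2 - (F^[J + n] x').2‖) +
            (1 - κ * lam) * (s / 2) / κ * ‖(F^[J + n] x).2 - (F^[J + n] x').2‖ := by gcongr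
        _ = (lam * (κ * lam) ^ n + s / 2 / κ) * ‖(F^[J + n] x).2 - (F^[J + n] x').2‖ := by
          field_simp; ring
        _ ≤ (lam * (κ * lam) ^ n + s / 2 / κ) *
            (κ * ‖(F (F^[J + n] x)).2 - (F (F^[J + n] x')).2‖) := by gcongr
        _ = _ := by field_simp; ring
  have hk := key (m - J) (by omega)
  rw [Nat.add_sub_cancel' (by omega)] at hk
  refine hk.trans (mul_le_mul_of_nonneg_right ?_ (norm_nonneg _))
  have : (κ * lam) ^ (m - J) ≤ (κ * lam) ^ i :=
    pow_le_pow_of_le_one hθ0 hθ.le (by omega)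
  linarith

/-- A long orbit segment in the box that ends at `|z| ≤ δ` starts close to the stable manifold. -/
theorem exists_norm_snd_lt_of_iterate_mem [FiniteDimensional ℝ Y] [FiniteDimensional ℝ Z]
    (hF : IsConeContraction F lam κ ω a b) {H : Y × Z → Y × Z}
    (hH : Continuous H) (hHF : Function.LeftInverse H F) {δ : ℝ}
    (hatt : ∀ τ > 0, ∃ M : ℕ, ∀ z ∈ closedBall (0 : Z) δ, ‖H^[M] (0, z)‖ < τ)
    {V : Y × Z → ℝ} (hV : ContinuousOn V (closedBall (0 : Y) a ×ˢ closedBall (0 : Z) b))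
    (hV0 : ∀ x ∈ closedBall (0 : Y) a ×ˢ closedBall (0 : Z) b, 0 ≤ V x)
    (hV1 : ∀ x ∈ closedBall (0 : Y) a ×ˢ closedBall (0 : Z) b, V x = 0 ↔ x.2 = 0)
    (hV2 : ∀ x ∈ closedBall (0 : Y) a ×ˢ closedBall (0 : Z) b,
      F x ∈ closedBall (0 : Y) a ×ˢ closedBall (0 : Z) b → V x ≤ V (F x))
    {r : ℝ} (hr : 0 < r) :
    ∃ n, ∀ m ≥ n, ∀ x : Y × Z,
      (∀ j ≤ m, F^[j] x ∈ closedBall (0 : Y) a ×ˢ closedBall (0 : Z) b) →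
      ‖(F^[m] x).2‖ ≤ δ → ‖x.2‖ < r := by
  set Q := closedBall (0 : Y) a ×ˢ closedBall (0 : Z) b with hQ
  have hQc : IsCompact Q := (isCompact_closedBall _ _).prod (isCompact_closedBall _ _)
  -- `V` is bounded below on the far part of the box
  obtain ⟨v, hv, Hv⟩ : ∃ v > 0, ∀ x ∈ Q, r ≤ ‖x.2‖ → v ≤ V x := by
    have hc : IsCompact (Q ∩ {x | r ≤ ‖x.2‖}) :=
      hQc.inter_right (isClosed_le continuous_const continuous_snd.norm)
    rcases (Q ∩ {x | r ≤ ‖x.2‖}).eq_empty_or_nonempty with he | hne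
    · refine ⟨1, one_pos, fun x hx hxr => ?_⟩
      have : x ∈ Q ∩ {x | r ≤ ‖x.2‖} := ⟨hx, hxr⟩
      simp [he] at this
    · obtain ⟨x₀, hx₀, hmin⟩ := hc.exists_isMinOn hne (hV.mono inter_subset_left)
      refine ⟨V x₀, (hV0 _ hx₀.1).lt_of_ne fun h => ?_, fun x hx hxr => hmin ⟨hx, hxr⟩⟩
      have := (hV1 _ hx₀.1).1 h.symm
      have h2 : r ≤ ‖x₀.2‖ := hx₀.2
      rw [this, norm_zero] at h2
      linarith
  -- Conversely, `V` vanishes on `z = 0`, so by compactness a lower bound on `V` keeps points away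
  -- from `z = 0`.
  obtain ⟨τ, hτ, Hτ⟩ : ∃ τ > 0, ∀ x ∈ Q, v ≤ V x → τ ≤ ‖x.2‖ := by
    have hc : IsCompact (Q ∩ V ⁻¹' Ici v) := by
      refine hQc.of_isClosed_subset ?_ inter_subset_left
      exact hV.preimage_isClosed_of_isClosed hQc.isClosed isClosed_Ici
    rcases (Q ∩ V ⁻¹' Ici v).eq_empty_or_nonempty with he | hne
    · refine ⟨1, one_pos, fun x hx hxr => ?_⟩
      have : x ∈ Q ∩ V ⁻¹' Ici v := ⟨hx, hxr⟩
      simp [he] at this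
    · obtain ⟨x₀, hx₀, hmin⟩ := hc.exists_isMinOn hne continuous_snd.norm.continuousOn
      refine ⟨‖x₀.2‖, (norm_nonneg _).lt_of_ne fun h => ?_, fun x hx hxr => hmin ⟨hx, hxr⟩⟩
      have := (hV1 _ hx₀.1).2 (norm_eq_zero.1 h.symm)
      have h2 : v ≤ V x₀ := hx₀.2
      linarith
  obtain ⟨M, hM⟩ := hatt τ hτ
  obtain ⟨a', ha', Ha'⟩ := exists_closedBall_prod_subset (x := (0 : Y))
    (isCompact_closedBall (0 : Z) δ) (O := {p | ‖H^[M] p‖ < τ})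
    (isOpen_lt (hH.iterate M).norm continuous_const) hM
  obtain ⟨J, hJ⟩ : ∃ J : ℕ, ∀ j ≥ J, lam ^ j * a ≤ a' := by
    have : Tendsto (fun j : ℕ => lam ^ j * a) atTop (𝓝 0) := by
      simpa using (tendsto_pow_atTop_nhds_zero_of_lt_one hF.lam_nonneg hF.lam_lt_one).mul_const a
    exact eventually_atTop.1 (this.eventually_le_const ha')
  refine ⟨max J M, fun m hm x hx hxm => ?_⟩
  by_contra! hxr
  -- The lower bound on `V` propagates to time `m - M` and forces `τ ≤ |z|` there, whereas `M`
  -- backward steps from the end of the segment give norm less than `τ`.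
  have hVj : ∀ j ≤ m, v ≤ V (F^[j] x) := by
    intro j
    induction j with
    | zero => exact fun _ => Hv x (hx 0 (by omega)) hxr
    | succ j ih =>
      intro hj
      have h1 := hx (j + 1) hj
      rw [Function.iterate_succ_apply'] at h1 ⊢
      exact (ih (by omega)).trans (hV2 _ (hx j (by omega)) h1)
  have hMm : M ≤ m := (le_max_right _ _).trans hm
  have h1 := Hτ _ (hx (m - M) (by omega)) (hVj (m - M) (by omega))
  have h2 : ‖(F^[m] x).1‖ ≤ a' := by
    refine (hF.norm_fst_iterate_le fun j hj => hx j hj.le).trans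
      (le_trans ?_ (hJ m ((le_max_left _ _).trans hm)))
    have : ‖x.1‖ ≤ a := by simpa using (hx 0 (by omega)).1
    have := hF.lam_nonneg
    gcongr
  have h3 : ‖H^[M] (F^[m] x)‖ < τ :=
    Ha' (show F^[m] x ∈ _ from ⟨by simpa using h2, by simpa using hxm⟩)
  have e : H^[M] (F^[m] x) = F^[m - M] x := by
    conv_lhs => rw [← Nat.add_sub_cancel' hMm, Function.iterate_add_apply]
    exact hHF.iterate M _
  rw [e] at h3
  exact absurd ((norm_snd_le _).trans_lt h3) (not_lt.2 h1)

end IsConeContraction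

end Dynamics

/-! ### Inverting an antilipschitz map over a ball -/

section Section

variable {Z : Type*} [NormedAddCommGroup Z] [NormedSpace ℝ Z]

/-- Along a kernel vector of the derivative the increments of `φ` are of smaller order than the
displacement, contradicting the linear lower bound. -/
theorem injective_of_antilipschitz_nhds {W : Type*} [NormedAddCommGroup W] [NormedSpace ℝ W]
    {φ : Z → W} {φ' : Z →L[ℝ] W} {z : Z} (hφ : HasFDerivAt φ φ' z) {c : ℝ}
    (h : ∀ᶠ z' in 𝓝 z, ‖z' - z‖ ≤ c * ‖φ z' - φ z‖) : Function.Injective φ' := by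
  rw [injective_iff_map_eq_zero]
  intro v hv
  by_contra hv0
  set ε : ℝ := 1 / (2 * (|c| + 1)) with hε
  have hεpos : 0 < ε := by positivity
  have h1 := hφ.isLittleO.def hεpos
  have ht : Tendsto (fun t : ℝ => z + t • v) (𝓝[>] 0) (𝓝 z) := by
    have : Continuous fun t : ℝ => z + t • v := by fun_prop
    have h0 := this.tendsto 0
    simp only [zero_smul, add_zero] at h0
    exact h0.mono_left nhdsWithin_le_nhds
  obtain ⟨t, ⟨h2, h3⟩, ht0⟩ := ((ht.eventually (h1.and h)).and self_mem_nhdsWithin).exists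
  have ht0 : (0 : ℝ) < t := ht0
  simp only [add_sub_cancel_left, map_smul, hv, smul_zero, sub_zero] at h2 h3
  have hpos : 0 < ‖t • v‖ := norm_pos_iff.2 (smul_ne_zero ht0.ne' hv0)
  have h4 : ‖t • v‖ ≤ (|c| + 1) * (ε * ‖t • v‖) := by
    refine h3.trans ?_
    have : c ≤ |c| + 1 := by linarith [le_abs_self c]
    calc c * _ ≤ (|c| + 1) * ‖φ (z + t • v) - φ z‖ := by gcongr
      _ ≤ _ := by gcongr
  have h5 : (|c| + 1) * (ε * ‖t • v‖) = ‖t • v‖ / 2 := by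
    rw [hε]; field_simp
  linarith

/-- A map that is antilipschitz on a compact set `K`, and `C^1` and interior to `K` wherever its
values are in a ball, has a `C^1` right inverse over this ball as soon as it attains the
centre. -/
theorem exists_contDiffOn_rightInverse [FiniteDimensional ℝ Z] {φ : Z → Z} {K : Set Z} {δ c : ℝ}
    (hδ : 0 < δ) (hK : IsCompact K) (hφ : ContinuousOn φ K)
    (hint : ∀ z ∈ K, ‖φ z‖ < δ → K ∈ 𝓝 z ∧ ContDiffAt ℝ 1 φ z)
    (hc : ∀ z ∈ K, ∀ z' ∈ K, ‖z - z'‖ ≤ c * ‖φ z - φ z'‖) (h0 : ∃ z ∈ K, φ z = 0) :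
    ∃ σ : Z → Z, ContDiffOn ℝ 1 σ (ball 0 δ) ∧ ∀ ζ ∈ ball (0 : Z) δ, σ ζ ∈ K ∧ φ (σ ζ) = ζ := by
  have hinj : ∀ z ∈ K, ∀ z' ∈ K, φ z = φ z' → z = z' := fun z hz z' hz' h => by
    have := hc z hz z' hz'
    rw [h, sub_self, norm_zero, mul_zero] at this
    exact sub_eq_zero.1 (norm_le_zero_iff.1 this)
  -- local inverses
  have hloc : ∀ z ∈ K, ‖φ z‖ < δ → ∃ ψ : Z → Z, ContDiffAt ℝ 1 ψ (φ z) ∧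
      ∀ᶠ ζ in 𝓝 (φ z), ψ ζ ∈ K ∧ φ (ψ ζ) = ζ := by
    intro z hz hzδ
    obtain ⟨hKz, hφz⟩ := hint z hz hzδ
    have hd : HasFDerivAt φ (fderiv ℝ φ z) z := (hφz.differentiableAt one_ne_zero).hasFDerivAt
    have hinj' : Function.Injective (fderiv ℝ φ z) :=
      injective_of_antilipschitz_nhds hd (by filter_upwards [hKz] with z' hz' using hc z' hz' z hz)
    set e : Z ≃L[ℝ] Z := (LinearEquiv.ofInjectiveEndo (fderiv ℝ φ z : Z →ₗ[ℝ] Z)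
      hinj').toContinuousLinearEquiv with he
    have hde : HasFDerivAt φ (e : Z →L[ℝ] Z) z := by
      have : (e : Z →L[ℝ] Z) = fderiv ℝ φ z := by ext w; simp [he]
      rwa [this]
    refine ⟨hφz.localInverse hde one_ne_zero, hφz.to_localInverse hde one_ne_zero, ?_⟩
    have hst := hφz.hasStrictFDerivAt' hde one_ne_zero
    have h1 := hst.eventually_right_inverse
    have h2 : Tendsto (hst.localInverse φ e z) (𝓝 (φ z)) (𝓝 z) := hst.localInverse_tendsto
    exact (h2.eventually hKz).and h1
  -- The part of the image in the ball is open by the local inverses, relatively closed by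
  -- compactness of `K`, and contains the centre; the ball is connected.
  have hsub : ball (0 : Z) δ ⊆ φ '' K ∩ ball 0 δ := by
    refine (convex_ball (0 : Z) δ).isPreconnected.subset_of_closure_inter_subset ?_ ?_ ?_
    · rw [isOpen_iff_mem_nhds]
      rintro _ ⟨⟨z, hz, rfl⟩, hzδ⟩
      obtain ⟨ψ, -, hψ⟩ := hloc z hz (by simpa using hzδ)
      filter_upwards [hψ, isOpen_ball.mem_nhds hzδ] with ζ hζ hζ' using ⟨⟨ψ ζ, hζ⟩, hζ'⟩
    · obtain ⟨z, hz, hz0⟩ := h0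
      exact ⟨0, mem_ball_self hδ, ⟨z, hz, hz0⟩, mem_ball_self hδ⟩
    · rintro ζ ⟨h, hζ⟩
      refine ⟨?_, hζ⟩
      exact (closure_minimal inter_subset_left (hK.image_of_continuousOn hφ).isClosed) h
  choose! σ hσ using fun ζ (hζ : ζ ∈ ball (0 : Z) δ) => (hsub hζ).1
  refine ⟨σ, fun ζ hζ => ?_, hσ⟩
  obtain ⟨h1, h2⟩ := hσ ζ hζ
  obtain ⟨ψ, hψ, hψ'⟩ := hloc (σ ζ) h1 (by rw [h2]; simpa using hζ)
  rw [h2] at hψ hψ'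
  -- Injectivity on `K` forces the chosen section to agree with the `C^1` local inverse.
  refine (hψ.congr_of_eventuallyEq ?_).contDiffWithinAt
  filter_upwards [hψ', isOpen_ball.mem_nhds hζ] with ζ' h3 h4
  exact hinj _ (hσ ζ' h4).1 _ h3.1 ((hσ ζ' h4).2.trans h3.2.symm)

end Section

theorem contDiff_iterate {X : Type*} [NormedAddCommGroup X] [NormedSpace ℝ X] {F : X → X}
    (hF : ContDiff ℝ 1 F) (k : ℕ) : ContDiff ℝ 1 F^[k] := by
  induction k with
  | zero => exact contDiff_id
  | succ k ih => exact ih.comp hF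

/-! ### Transversal disks enter the cone after finitely many iterations -/

section InitialPiece

variable {Y Z : Type*} [NormedAddCommGroup Y] [NormedSpace ℝ Y] [FiniteDimensional ℝ Y]
  [NormedAddCommGroup Z] [NormedSpace ℝ Z]

/-- A continuous family of injective linear maps is uniformly bounded below on compact sets. -/
theorem exists_forall_mul_norm_le [FiniteDimensional ℝ Z] {X W : Type*} [TopologicalSpace X]
    [NormedAddCommGroup W] [NormedSpace ℝ W] {K : Set X} (hK : IsCompact K) {L : X → Z →L[ℝ] W}
    (hL : ContinuousOn L K) (hinj : ∀ x ∈ K, Function.Injective (L x)) :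
    ∃ μ > 0, ∀ x ∈ K, ∀ w, μ * ‖w‖ ≤ ‖L x w‖ := by
  have hc : IsCompact (K ×ˢ sphere (0 : Z) 1) := hK.prod (isCompact_sphere _ _)
  have hf : ContinuousOn (fun p : X × Z => ‖L p.1 p.2‖) (K ×ˢ sphere (0 : Z) 1) :=
    ((hL.comp continuousOn_fst fun p hp => hp.1).clm_apply continuousOn_snd).norm
  obtain ⟨μ, hμ, H⟩ : ∃ μ > 0, ∀ p ∈ K ×ˢ sphere (0 : Z) 1, μ ≤ ‖L p.1 p.2‖ := by
    rcases (K ×ˢ sphere (0 : Z) 1).eq_empty_or_nonempty with he | hne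
    · exact ⟨1, one_pos, by simp [he]⟩
    · obtain ⟨p, hp, hmin⟩ := hc.exists_isMinOn hne hf
      refine ⟨_, norm_pos_iff.2 fun h => ?_, fun q hq => hmin hq⟩
      have := hinj _ hp.1 (h.trans (map_zero _).symm)
      have h1 : ‖p.2‖ = 1 := by simpa using hp.2
      rw [this, norm_zero] at h1
      exact zero_ne_one h1
  refine ⟨μ, hμ, fun x hx w => ?_⟩
  rcases eq_or_ne w 0 with rfl | hw
  · simp
  have hw' : 0 < ‖w‖ := norm_pos_iff.2 hw
  have := H (x, ‖w‖⁻¹ • w) ⟨hx, by simp [norm_smul, hw'.ne']⟩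
  simp only [map_smul, norm_smul, norm_inv, norm_norm] at this
  rwa [inv_mul_eq_div, le_div_iff₀ hw'] at this

/-- The lower diagonal block of an injective block triangular endomorphism is injective. -/
theorem injective_snd_comp_inr {A : Y × Z →L[ℝ] Y × Z} (hA : Function.Injective A)
    (h : ∀ v, (A (v, 0)).2 = 0) :
    Function.Injective
      ((ContinuousLinearMap.snd ℝ Y Z).comp (A.comp (ContinuousLinearMap.inr ℝ Y Z))) := by
  set T : Y →ₗ[ℝ] Y :=
    (((ContinuousLinearMap.fst ℝ Y Z).comp (A.comp (ContinuousLinearMap.inl ℝ Y Z)) :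
      Y →L[ℝ] Y) : Y →ₗ[ℝ] Y) with hT
  have hTA : ∀ v, A (v, 0) = (T v, 0) := fun v => Prod.ext (by simp [hT]) (h v)
  have hTi : Function.Injective T := fun v v' hv => by
    have : A (v, 0) = A (v', 0) := by rw [hTA, hTA, hv]
    exact (Prod.ext_iff.1 (hA this)).1
  have hTs : Function.Surjective T := LinearMap.surjective_of_injective hTi
  rw [injective_iff_map_eq_zero]
  intro w hw
  obtain ⟨v, hv⟩ := hTs (A (0, w)).1
  have : A (v, 0) = A (0, w) := by
    rw [hTA, hv]
    exact Prod.ext rfl (by simpa using hw.symm)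
  exact (Prod.ext_iff.1 (hA this)).2.symm

/-- Disks transversal to the stable manifold become, after sufficiently many iterations and close
to the stable manifold, graphs with slopes at most one in a small box around the fixed point. -/
theorem exists_iterate_cone [FiniteDimensional ℝ Z] {F : Y × Z → Y × Z} {lam κ ω a b : ℝ}
    (hFc : ContDiff ℝ 1 F)
    (hFinj : ∀ x, Function.Injective (fderiv ℝ F x)) (hF : IsConeContraction F lam κ ω a b)
    (hb : 0 ≤ b) {Φ : Y × Z → Y × Z} {T : Set (Y × Z)} (hT : IsOpen T) (hΦ : ContDiffOn ℝ 1 Φ T)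
    (hΦinj : ∀ x ∈ T, Function.Injective (fderiv ℝ Φ x)) {c : Y} {a₁ b₁ : ℝ} (ha₁ : 0 < a₁)
    (hb₁ : 0 < b₁) (hbox : closedBall c a₁ ×ˢ closedBall (0 : Z) b₁ ⊆ T)
    (hz : ∀ k, ∀ y ∈ closedBall c a₁, (F^[k] (Φ (y, 0))).2 = 0)
    (hlim : ∃ k₀, ∀ k ≥ k₀, ∀ y ∈ closedBall c a₁, ‖F^[k] (Φ (y, 0))‖ < a) :
    ∃ (k : ℕ) (r q : ℝ), 0 < r ∧ r ≤ b₁ ∧ 0 < q ∧ ∀ η : Z → Y,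
      (∀ z ∈ closedBall (0 : Z) r, η z ∈ closedBall c a₁) →
      (∀ z ∈ closedBall (0 : Z) r, ∀ z' ∈ closedBall (0 : Z) r, ‖η z - η z'‖ ≤ ‖z - z'‖) →
      ∀ z ∈ closedBall (0 : Z) r, ‖(F^[k] (Φ (η z, z))).1‖ < a ∧
        ∀ z' ∈ closedBall (0 : Z) r,
        ‖(F^[k] (Φ (η z, z))).1 - (F^[k] (Φ (η z', z'))).1‖ ≤
          ‖(F^[k] (Φ (η z, z))).2 - (F^[k] (Φ (η z', z'))).2‖ ∧
        ‖z - z'‖ ≤ q * ‖(F^[k] (Φ (η z, z))).2 - (F^[k] (Φ (η z', z'))).2‖ := by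
  obtain ⟨k₀, hk₀⟩ := hlim
  set P : ℕ → Y × Z → Y × Z := fun k x => F^[k] (Φ x) with hP
  have hPc : ∀ k, ContDiffOn ℝ 1 (P k) T := fun k => (contDiff_iterate hFc k).comp_contDiffOn hΦ
  have hPd : ∀ k, ∀ x ∈ T, HasFDerivAt (P k) (fderiv ℝ (P k) x) x := fun k x hx =>
    (((hPc k).differentiableOn one_ne_zero x hx).differentiableAt (hT.mem_nhds hx)).hasFDerivAt
  have hPG : ∀ k, ContinuousOn (fderiv ℝ (P k)) T := fun k =>
    (hPc k).continuousOn_fderiv_of_isOpen hT le_rfl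
  have hstep : ∀ k, ∀ x ∈ T,
      fderiv ℝ (P (k + 1)) x = (fderiv ℝ F (P k x)).comp (fderiv ℝ (P k) x) := fun k x hx => by
    have h1 : HasFDerivAt (F ∘ P k) ((fderiv ℝ F (P k x)).comp (fderiv ℝ (P k) x)) x :=
      (hFc.differentiable one_ne_zero _).hasFDerivAt.comp x (hPd k x hx)
    have h2 : P (k + 1) = F ∘ P k := funext fun x => Function.iterate_succ_apply' F k (Φ x)
    rw [h2, h1.fderiv]
  have hinj : ∀ k, ∀ x ∈ T, Function.Injective (fderiv ℝ (P k) x) := fun k x hx => by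
    induction k with
    | zero => exact hΦinj x hx
    | succ k ih =>
      rw [hstep k x hx]
      exact (hFinj _).comp ih
  have hKT : ∀ y ∈ closedBall c a₁, (y, (0 : Z)) ∈ T := fun y hy =>
    hbox ⟨hy, by simpa using hb₁.le⟩
  -- the tangent maps preserve the stable direction
  have htri : ∀ k, ∀ y ∈ closedBall c a₁, ∀ v, (fderiv ℝ (P k) (y, 0) (v, 0)).2 = 0 := by
    intro k y hy v
    have e1 : HasFDerivAt (fun y => (P k (y, (0 : Z))).2) ((ContinuousLinearMap.snd ℝ Y Z).comp
        ((fderiv ℝ (P k) (y, 0)).comp (ContinuousLinearMap.inl ℝ Y Z))) y :=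
      hasFDerivAt_snd.comp y (HasFDerivAt.comp (f := fun y => (y, (0 : Z))) y
        (hPd k _ (hKT y hy)) (hasFDerivAt_prodMk_left y (0 : Z)))
    have e2 : HasFDerivWithinAt (fun y => (P k (y, (0 : Z))).2) (0 : Y →L[ℝ] Z)
        (closedBall c a₁) y :=
      (hasFDerivWithinAt_const (0 : Z) y _).congr (fun y' hy' => hz k y' hy') (hz k y hy)
    -- At boundary points of the ball the vanishing is known only inside it, so derivatives within
    -- the ball are compared.
    have hu : UniqueDiffWithinAt ℝ (closedBall c a₁) y :=
      uniqueDiffOn_convex (convex_closedBall c a₁)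
        ⟨c, by rw [interior_closedBall _ ha₁.ne']; exact mem_ball_self ha₁⟩ y hy
    have := congrArg (fun S => S v) (hu.eq e1.hasFDerivWithinAt e2)
    simpa using this
  have hsnd : ∀ k, ∀ y ∈ closedBall c a₁, ∀ v w,
      (fderiv ℝ (P k) (y, 0) (v, w)).2 = (fderiv ℝ (P k) (y, 0) (0, w)).2 := by
    intro k y hy v w
    have : ((v, w) : Y × Z) = (v, 0) + (0, w) := by simp
    rw [this, map_add, Prod.snd_add, htri k y hy, zero_add]
  have hcont0 : ∀ k, ContinuousOn (fun y => fderiv ℝ (P k) (y, (0 : Z))) (closedBall c a₁) :=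
    fun k => (hPG k).comp (Continuous.prodMk_left 0).continuousOn hKT
  have hlower : ∀ k, ∃ μ > 0, ∀ y ∈ closedBall c a₁, ∀ v w,
      μ * ‖w‖ ≤ ‖(fderiv ℝ (P k) (y, 0) (v, w)).2‖ := by
    intro k
    obtain ⟨μ, hμ, H⟩ := exists_forall_mul_norm_le (isCompact_closedBall c a₁)
      (L := fun y => (ContinuousLinearMap.snd ℝ Y Z).comp
        ((fderiv ℝ (P k) (y, 0)).comp (ContinuousLinearMap.inr ℝ Y Z)))
      (continuousOn_const.clm_comp ((hcont0 k).clm_comp continuousOn_const))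
      (fun y hy => injective_snd_comp_inr (hinj k _ (hKT y hy)) (htri k y hy))
    refine ⟨μ, hμ, fun y hy v w => ?_⟩
    rw [hsnd k y hy]
    simpa using H y hy w
  -- an initial bound of the slopes
  obtain ⟨S, hS0, hS⟩ : ∃ S ≥ 0, ∀ y ∈ closedBall c a₁, ∀ v w, ‖v‖ ≤ ‖w‖ →
      ‖(fderiv ℝ (P k₀) (y, 0) (v, w)).1‖ ≤ S * ‖(fderiv ℝ (P k₀) (y, 0) (v, w)).2‖ := by
    obtain ⟨μ, hμ, H⟩ := hlower k₀
    obtain ⟨N, hN⟩ := (isCompact_closedBall c a₁).exists_bound_of_continuousOn (hcont0 k₀)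
    refine ⟨|N| / μ, by positivity, fun y hy v w hvw => ?_⟩
    have h1 : ‖(fderiv ℝ (P k₀) (y, 0) (v, w)).1‖ ≤ |N| * ‖w‖ := by
      refine (norm_fst_le _).trans (((fderiv ℝ (P k₀) (y, 0)).le_of_opNorm_le
        ((hN y hy).trans (le_abs_self N)) (v, w)).trans ?_)
      rw [Prod.norm_mk, max_eq_right hvw]
    refine h1.trans ?_
    rw [div_mul_eq_mul_div, mul_div_assoc]
    refine mul_le_mul_of_nonneg_left ?_ (abs_nonneg N)
    rw [le_div_iff₀ hμ, mul_comm]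
    exact H y hy v w
  -- the slopes decrease
  have hl := hF.lam_nonneg
  have hκ := hF.κ_pos
  have hω := hF.ω_pos
  set θ := κ * lam with hθdef
  have hθ0 : 0 ≤ θ := by positivity
  have hθω : θ + κ * ω < 1 := by have := hF.κ_mul_lt_one; rw [hθdef]; linarith
  have hθ1 : 0 < 1 - θ := by nlinarith
  -- `β` is the fixed point of the slope recursion `t ↦ θ t + κ ω`; since `κ (lam + ω) < 1` it is
  -- less than one, so every initial bound `S` is eventually brought below one.
  set β := κ * ω / (1 - θ) with hβ
  have hβ0 : 0 ≤ β := by positivity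
  have hβ1 : β < 1 := by rw [hβ, div_lt_one hθ1]; linarith
  have hβeq : θ * β + κ * ω = β := by rw [hβ]; field_simp; ring
  have hslope : ∀ j, ∀ y ∈ closedBall c a₁, ∀ v w, ‖v‖ ≤ ‖w‖ →
      ‖(fderiv ℝ (P (k₀ + j)) (y, 0) (v, w)).1‖ ≤
        (θ ^ j * S + β) * ‖(fderiv ℝ (P (k₀ + j)) (y, 0) (v, w)).2‖ := by
    intro j y hy v w hvw
    induction j with
    | zero =>
      refine (hS y hy v w hvw).trans (mul_le_mul_of_nonneg_right ?_ (norm_nonneg _))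
      linarith
    | succ j ih =>
      rw [← add_assoc, hstep _ _ (hKT y hy), ContinuousLinearMap.comp_apply]
      set x := fderiv ℝ (P (k₀ + j)) (y, 0) (v, w) with hx
      have hPz : (P (k₀ + j) (y, 0)).2 = 0 := hz _ y hy
      have hPa : ‖(P (k₀ + j) (y, 0)).1‖ < a :=
        (norm_fst_le _).trans_lt (hk₀ (k₀ + j) (by omega) y hy)
      have hPe : P (k₀ + j) (y, 0) = ((P (k₀ + j) (y, 0)).1, 0) := Prod.ext rfl hPz
      have h1 := hF.tangent_slope (P (k₀ + j) (y, 0))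
        ⟨by simpa using hPa.le, by rw [hPz]; simpa using hb⟩ x.1 x.2
      have h2 := hF.tangent_expand (P (k₀ + j) (y, 0)).1 (by simpa using hPa) x.1 x.2
      rw [← hPe] at h2
      simp only [Prod.mk.eta] at h1 h2
      calc _ ≤ _ := h1
        _ ≤ lam * ((θ ^ j * S + β) * ‖x.2‖) + ω * ‖x.2‖ := by gcongr
        _ = (lam * (θ ^ j * S + β) + ω) * ‖x.2‖ := by ring
        _ ≤ (lam * (θ ^ j * S + β) + ω) * (κ * ‖(fderiv ℝ F (P (k₀ + j) (y, 0)) x).2‖) := by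
          gcongr
        _ = (θ ^ (j + 1) * S + (θ * β + κ * ω)) * ‖(fderiv ℝ F (P (k₀ + j) (y, 0)) x).2‖ := by
          rw [hθdef]; ring
        _ = _ := by rw [hβeq]
  obtain ⟨j, hj⟩ : ∃ j : ℕ, θ ^ j * S + β < 1 := by
    have h1 : Tendsto (fun j : ℕ => θ ^ j * S + β) atTop (𝓝 β) := by
      simpa using ((tendsto_pow_atTop_nhds_zero_of_lt_one hθ0 (by linarith)).mul_const S).add_const β
    exact (h1.eventually_lt_const hβ1).exists
  set k := k₀ + j with hk
  set s := θ ^ j * S + β with hs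
  have hs0 : 0 ≤ s := by positivity
  have hsl := hslope j
  obtain ⟨μ, hμ, Hμ⟩ := hlower k
  -- An error `ε ‖z - z'‖` in each component then uses up exactly the slack between slope `s` and
  -- slope one, and leaves at least half of the lower bound `μ`, whence `q = 2 / μ`.
  set ε := (1 - s) * μ / 2 with hε
  have hεpos : 0 < ε := by have : 0 < 1 - s := by linarith
                           positivity
  -- uniform closeness of the tangent maps
  have hboxc : IsCompact (closedBall c a₁ ×ˢ closedBall (0 : Z) b₁) :=
    (isCompact_closedBall _ _).prod (isCompact_closedBall _ _)
  obtain ⟨d, hd, Hd⟩ := Metric.uniformContinuousOn_iff.1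
    (hboxc.uniformContinuousOn_of_continuous ((hPG k).mono hbox)) ε hεpos
  obtain ⟨r', hr', Hr'⟩ := exists_closedBall_prod_subset (x := (0 : Z))
    (isCompact_closedBall c a₁)
    (O := Prod.swap ⁻¹' (T ∩ P k ⁻¹' {x | ‖x.1‖ < a}))
    (((hPc k).continuousOn.isOpen_inter_preimage hT
      (isOpen_lt continuous_fst.norm continuous_const)).preimage continuous_swap)
    (fun y hy => ⟨hKT y hy, (norm_fst_le _).trans_lt (hk₀ k (by omega) y hy)⟩)
  obtain ⟨r, hr, hrb, hrr', hrd⟩ : ∃ r > 0, r ≤ b₁ ∧ r ≤ r' ∧ 2 * r < d :=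
    ⟨min b₁ (min r' (d / 3)), by positivity, min_le_left _ _,
      (min_le_right _ _).trans (min_le_left _ _), by
        have := (min_le_right b₁ _).trans (min_le_right r' (d / 3)); linarith⟩
  refine ⟨k, r, 2 / μ, hr, hrb, by positivity, fun η hη hηl z hzr => ⟨?_, fun z' hzr' => ?_⟩⟩
  · exact (Hr' (show (z, η z) ∈ _ from
      ⟨closedBall_subset_closedBall hrr' hzr, hη z hzr⟩)).2
  · have hzn : ‖z‖ ≤ r := by simpa using hzr
    have hzn' : ‖z'‖ ≤ r := by simpa using hzr'
    have hle := hηl z hzr z' hzr'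
    have hzz : ‖z - z'‖ ≤ 2 * r := (norm_sub_le _ _).trans (by linarith)
    have hq : (η z, (0 : Z)) ∈ closedBall c a₁ ×ˢ closedBall (0 : Z) b₁ :=
      ⟨hη z hzr, by simpa using hb₁.le⟩
    have hx : (η z, z) ∈ (closedBall c a₁ ×ˢ closedBall (0 : Z) b₁) ∩ ball (η z, 0) d := by
      refine ⟨⟨hη z hzr, closedBall_subset_closedBall hrb hzr⟩, ?_⟩
      rw [mem_ball, dist_eq_norm, Prod.mk_sub_mk, Prod.norm_mk, max_lt_iff]
      simp only [sub_self, norm_zero, sub_zero]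
      exact ⟨hd, by linarith⟩
    have hx' : (η z', z') ∈ (closedBall c a₁ ×ˢ closedBall (0 : Z) b₁) ∩ ball (η z, 0) d := by
      refine ⟨⟨hη z' hzr', closedBall_subset_closedBall hrb hzr'⟩, ?_⟩
      rw [mem_ball, dist_eq_norm, Prod.mk_sub_mk, Prod.norm_mk, max_lt_iff, sub_zero,
        norm_sub_rev]
      exact ⟨by linarith, by linarith⟩
    -- The mean value inequality on a convex piece of the box, against the derivative at the point
    -- `(η z, 0)` of the stable manifold, turns tangent estimates into chord estimates.
    have hmv := (((convex_closedBall c a₁).prod (convex_closedBall (0 : Z) b₁)).inter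
      (convex_ball (η z, (0 : Z)) d)).norm_image_sub_le_of_norm_hasFDerivWithin_le'
      (f := P k) (φ := fderiv ℝ (P k) (η z, 0))
      (fun x hx => (hPd k x (hbox hx.1)).hasFDerivWithinAt)
      (fun x hx => by
        have := Hd x hx.1 _ hq hx.2
        rw [dist_eq_norm] at this
        exact this.le) hx' hx
    have hsub : ((η z, z) : Y × Z) - (η z', z') = (η z - η z', z - z') := rfl
    rw [hsub, Prod.norm_mk (η z - η z'), max_eq_right hle] at hmv
    have g1 := hsl (η z) (hη z hzr) _ _ hle
    have g2 := Hμ (η z) (hη z hzr) (η z - η z') (z - z')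
    set A := fderiv ℝ (P k) (η z, 0) (η z - η z', z - z') with hA
    have m1 := (norm_fst_le _).trans hmv
    have m2 := (norm_snd_le _).trans hmv
    rw [Prod.fst_sub, Prod.fst_sub] at m1
    rw [Prod.snd_sub, Prod.snd_sub] at m2
    have n1 := norm_sub_norm_le ((P k (η z, z)).1 - (P k (η z', z')).1) A.1
    have n2 := norm_sub_norm_le A.2 ((P k (η z, z)).2 - (P k (η z', z')).2)
    rw [norm_sub_rev A.2] at n2
    have hd0 := norm_nonneg (z - z')
    have g3 : (1 - s) * (μ * ‖z - z'‖) ≤ (1 - s) * ‖A.2‖ :=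
      mul_le_mul_of_nonneg_left g2 (by linarith)
    have he : ε * ‖z - z'‖ = (1 - s) * (μ * ‖z - z'‖) / 2 := by rw [hε]; ring
    change ‖(P k (η z, z)).1 - (P k (η z', z')).1‖ ≤ ‖(P k (η z, z)).2 - (P k (η z', z')).2‖ ∧ _ ≤
      _ * ‖(P k (η z, z)).2 - (P k (η z', z')).2‖
    constructor
    · nlinarith
    · rw [div_mul_eq_mul_div, le_div_iff₀ hμ]
      have : (1 - s) * (μ * ‖z - z'‖) ≤ μ * ‖z - z'‖ :=
        mul_le_of_le_one_left (by positivity) (by linarith)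
      linarith

end InitialPiece

/-! ### Graphs over a fixed ball inside the iterated disks -/

section Graphs

variable {Y Z : Type*} [NormedAddCommGroup Y] [NormedSpace ℝ Y]
  [NormedAddCommGroup Z] [NormedSpace ℝ Z] [FiniteDimensional ℝ Z]

/-- The iterates of disks that are graphs with slopes at most one and reach the stable manifold
contain graphs over a fixed ball with uniformly small slopes and heights. -/
theorem IsConeContraction.exists_graph_subset_iterate {F : Y × Z → Y × Z} {lam κ ω a b : ℝ}
    (hF : IsConeContraction F lam κ ω a b) (hFc : ContDiff ℝ 1 F) (hb : 0 < b)
    {δ : ℝ} (hδ : 0 < δ)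
    (hin : ∀ m x, (∀ j ≤ m, F^[j] x ∈ closedBall (0 : Y) a ×ˢ closedBall (0 : Z) b) →
      ‖(F^[m] x).2‖ ≤ δ → ∀ j ≤ m, ‖(F^[j] x).2‖ < b)
    (hexit : ∀ r > 0, ∃ n, ∀ m ≥ n, ∀ x : Y × Z,
      (∀ j ≤ m, F^[j] x ∈ closedBall (0 : Y) a ×ˢ closedBall (0 : Z) b) →
      ‖(F^[m] x).2‖ ≤ δ → ‖x.2‖ < r)
    {r q : ℝ} (hr : 0 < r) (hq : 0 < q) {ε : ℝ} (hε : 0 < ε) :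
    ∃ n, ∀ m ≥ n, ∀ γ : Z → Y × Z, ContinuousOn γ (closedBall 0 r) →
      (∀ z ∈ ball (0 : Z) r, ContDiffAt ℝ 1 γ z) → (γ 0).2 = 0 →
      (∀ z ∈ closedBall (0 : Z) r, ‖(γ z).1‖ < a ∧ ∀ z' ∈ closedBall (0 : Z) r,
        ‖(γ z).1 - (γ z').1‖ ≤ ‖(γ z).2 - (γ z').2‖ ∧ ‖z - z'‖ ≤ q * ‖(γ z).2 - (γ z').2‖) →
      ∃ h : Z → Y × Z, ContDiffOn ℝ 1 h (ball 0 δ) ∧ ∀ ζ ∈ ball (0 : Z) δ,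
        (h ζ).2 = ζ ∧ ‖(h ζ).1‖ ≤ ε ∧ (∃ z ∈ closedBall (0 : Z) r, F^[m] (γ z) = h ζ) ∧
        ∀ ζ' ∈ ball (0 : Z) δ, ‖(h ζ).1 - (h ζ').1‖ ≤ ε * ‖ζ - ζ'‖ := by
  -- Since `‖z‖ ≤ q * ‖(γ z).2‖`, a starting height below `r / q` forces the parameter into the open
  -- ball of radius `r`.
  obtain ⟨n₁, hn₁⟩ := hexit (r / q) (by positivity)
  obtain ⟨n₂, hn₂⟩ := hF.exists_slope_iterate_le hε
  obtain ⟨n₃, hn₃⟩ : ∃ J : ℕ, ∀ j ≥ J, lam ^ j * a ≤ ε := by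
    have : Tendsto (fun j : ℕ => lam ^ j * a) atTop (𝓝 0) := by
      simpa using (tendsto_pow_atTop_nhds_zero_of_lt_one hF.lam_nonneg hF.lam_lt_one).mul_const a
    exact eventually_atTop.1 (this.eventually_le_const hε)
  refine ⟨max n₁ (max n₂ n₃), fun m hm γ hγc hγd hγ0 hγ => ?_⟩
  have hm₁ : n₁ ≤ m := (le_max_left _ _).trans hm
  have hm₂ : n₂ ≤ m := ((le_max_left _ _).trans (le_max_right _ _)).trans hm
  have hm₃ : n₃ ≤ m := ((le_max_right _ _).trans (le_max_right _ _)).trans hm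
  set Q := closedBall (0 : Y) a ×ˢ closedBall (0 : Z) b with hQ
  have hQc : IsClosed Q := isClosed_closedBall.prod isClosed_closedBall
  have hcont : ∀ j, ContinuousOn (fun z => F^[j] (γ z)) (closedBall 0 r) := fun j =>
    (hFc.continuous.iterate j).comp_continuousOn hγc
  -- The parameters whose orbits stay in the box up to time `m`.
  set K : Set Z := ⋂ j ∈ Iic m, closedBall 0 r ∩ (fun z => F^[j] (γ z)) ⁻¹' Q with hKdef
  have hK : ∀ z, z ∈ K ↔ z ∈ closedBall (0 : Z) r ∧ ∀ j ≤ m, F^[j] (γ z) ∈ Q := by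
    intro z
    simp only [hKdef, mem_iInter, mem_inter_iff, mem_Iic, mem_preimage]
    exact ⟨fun h => ⟨(h 0 (Nat.zero_le _)).1, fun j hj => (h j hj).2⟩,
      fun h j hj => ⟨h.1, h.2 j hj⟩⟩
  have hKc : IsCompact K := by
    refine (isCompact_closedBall (0 : Z) r).of_isClosed_subset ?_ fun z hz => ((hK z).1 hz).1
    exact isClosed_biInter fun j _ => (hcont j).preimage_isClosed_of_isClosed isClosed_closedBall hQc
  -- If the orbit ends at `|z| ≤ δ`, every constraint defining `K` is strict: the radius by `hexit`,
  -- the `y`-bound by contraction, the `z`-bound by `hin`. So `K` is a neighbourhood of such a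
  -- parameter.
  have hinner : ∀ z ∈ K, ‖(F^[m] (γ z)).2‖ ≤ δ → z ∈ ball (0 : Z) r ∧
      ∀ j ≤ m, F^[j] (γ z) ∈ ball (0 : Y) a ×ˢ ball (0 : Z) b := by
    intro z hz hzδ
    obtain ⟨hzr, hzQ⟩ := (hK z).1 hz
    refine ⟨?_, fun j hj => ⟨?_, ?_⟩⟩
    · have h1 := hn₁ m hm₁ _ hzQ hzδ
      have h2 := ((hγ z hzr).2 0 (by simpa using hr.le)).2
      rw [hγ0, sub_zero, sub_zero] at h2
      rw [lt_div_iff₀ hq, mul_comm] at h1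
      simpa using h2.trans_lt h1
    · have h1 := hF.norm_fst_iterate_le (x := γ z) (m := j) fun i hi => hzQ i (by omega)
      have h2 : lam ^ j ≤ 1 := pow_le_one₀ hF.lam_nonneg hF.lam_lt_one.le
      have h3 := (hγ z hzr).1
      simpa using (h1.trans (mul_le_of_le_one_left (norm_nonneg _) h2)).trans_lt h3
    · simpa using hin m _ hzQ hzδ j hj
  have hconeK : ∀ z ∈ K, ∀ z' ∈ K, ‖z - z'‖ ≤
      q * κ ^ m * ‖(F^[m] (γ z)).2 - (F^[m] (γ z')).2‖ := by
    intro z hz z' hz'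
    obtain ⟨hzr, hzQ⟩ := (hK z).1 hz
    obtain ⟨hzr', hzQ'⟩ := (hK z').1 hz'
    obtain ⟨h1, h2⟩ := (hγ z hzr).2 z' hzr'
    have h3 := (hF.cone_iterate (m := m) (fun j hj => hzQ j hj.le) (fun j hj => hzQ' j hj.le) h1).2
    calc _ ≤ _ := h2
      _ ≤ _ := mul_le_mul_of_nonneg_left h3 hq.le
      _ = _ := by ring
  have hdiff : ∀ z ∈ ball (0 : Z) r, ContDiffAt ℝ 1 (fun z => F^[m] (γ z)) z := fun z hz =>
    (contDiff_iterate hFc m).contDiffAt.comp z (hγd z hz)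
  -- The centre of the disk lies on `{z = 0}` and never leaves it; it is the parameter mapped to
  -- `0`.
  have hzero : ∀ j, (F^[j] (γ 0)).2 = 0 ∧ ‖(F^[j] (γ 0)).1‖ ≤ a := by
    intro j
    induction j with
    | zero => exact ⟨hγ0, (hγ 0 (by simpa using hr.le)).1.le⟩
    | succ j ih =>
      have hmem : F^[j] (γ 0) ∈ Q := ⟨by simpa using ih.2, by rw [ih.1]; simpa using hb.le⟩
      rw [Function.iterate_succ_apply']
      refine ⟨hF.snd_eq_zero _ hmem ih.1, (hF.norm_fst_le _ hmem).trans ?_⟩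
      exact (mul_le_of_le_one_left (norm_nonneg _) hF.lam_lt_one.le).trans ih.2
  obtain ⟨σ, hσc, hσ⟩ := exists_contDiffOn_rightInverse (φ := fun z => (F^[m] (γ z)).2) hδ hKc
    (continuous_snd.comp_continuousOn ((hcont m).mono fun z hz => ((hK z).1 hz).1))
    (fun z hz hzδ => by
      obtain ⟨h1, h2⟩ := hinner z hz hzδ.le
      refine ⟨?_, (hdiff z h1).snd⟩
      refine (biInter_mem (finite_Iic m)).2 fun j hj => ?_
      have hzn : closedBall (0 : Z) r ∈ 𝓝 z :=
        mem_of_superset (isOpen_ball.mem_nhds h1) ball_subset_closedBall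
      refine inter_mem hzn (((hcont j).continuousAt hzn).preimage_mem_nhds ?_)
      exact mem_of_superset ((isOpen_ball.prod isOpen_ball).mem_nhds (h2 j hj))
        (prod_mono ball_subset_closedBall ball_subset_closedBall))
    hconeK
    ⟨0, (hK 0).2 ⟨by simpa using hr.le, fun j _ => ⟨by simpa using (hzero j).2, by
      rw [(hzero j).1]; simpa using hb.le⟩⟩, (hzero m).1⟩
  refine ⟨fun ζ => F^[m] (γ (σ ζ)), fun ζ hζ => ?_, fun ζ hζ => ?_⟩
  · obtain ⟨h1, h2⟩ := hσ ζ hζ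
    have h3 := (hinner _ h1 (by rw [h2]; exact (by simpa using hζ : ‖ζ‖ < δ).le)).1
    exact ((hdiff _ h3).comp ζ ((hσc ζ hζ).contDiffAt (isOpen_ball.mem_nhds hζ))).contDiffWithinAt
  · obtain ⟨h1, h2⟩ := hσ ζ hζ
    obtain ⟨hzr, hzQ⟩ := (hK _).1 h1
    refine ⟨h2, ?_, ⟨σ ζ, hzr, rfl⟩, fun ζ' hζ' => ?_⟩
    · refine (hF.norm_fst_iterate_le fun j hj => hzQ j hj.le).trans (le_trans ?_ (hn₃ m hm₃))
      exact mul_le_mul_of_nonneg_left (hγ _ hzr).1.le (pow_nonneg hF.lam_nonneg _)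
    · obtain ⟨h1', h2'⟩ := hσ ζ' hζ'
      obtain ⟨hzr', hzQ'⟩ := (hK _).1 h1'
      have := hn₂ m hm₂ _ _ (fun j hj => hzQ j hj.le) (fun j hj => hzQ' j hj.le)
        ((hγ _ hzr).2 _ hzr').1
      have e : (F^[m] (γ (σ ζ))).2 = ζ := h2
      have e' : (F^[m] (γ (σ ζ'))).2 = ζ' := h2'
      rwa [e, e'] at this

/-- The inclination lemma for a family of disks that are graphs in a `C^1` coordinate system `Φ`
straightening the stable manifold. -/
theorem IsConeContraction.exists_graph_subset_iterate_of_chart [FiniteDimensional ℝ Y] {F : Y × Z → Y × Z}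
    {lam κ ω a b : ℝ} (hF : IsConeContraction F lam κ ω a b) (hFc : ContDiff ℝ 1 F)
    (hFinj : ∀ x, Function.Injective (fderiv ℝ F x)) (hb : 0 < b)
    {δ : ℝ} (hδ : 0 < δ)
    (hin : ∀ m x, (∀ j ≤ m, F^[j] x ∈ closedBall (0 : Y) a ×ˢ closedBall (0 : Z) b) →
      ‖(F^[m] x).2‖ ≤ δ → ∀ j ≤ m, ‖(F^[j] x).2‖ < b)
    (hexit : ∀ r > 0, ∃ n, ∀ m ≥ n, ∀ x : Y × Z,
      (∀ j ≤ m, F^[j] x ∈ closedBall (0 : Y) a ×ˢ closedBall (0 : Z) b) →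
      ‖(F^[m] x).2‖ ≤ δ → ‖x.2‖ < r)
    {Φ : Y × Z → Y × Z} {T : Set (Y × Z)} (hT : IsOpen T) (hΦ : ContDiffOn ℝ 1 Φ T)
    (hΦinj : ∀ x ∈ T, Function.Injective (fderiv ℝ Φ x)) {c : Y} {a₁ b₁ : ℝ} (ha₁ : 0 < a₁)
    (hb₁ : 0 < b₁) (hbox : closedBall c a₁ ×ˢ closedBall (0 : Z) b₁ ⊆ T)
    (hz : ∀ k, ∀ y ∈ closedBall c a₁, (F^[k] (Φ (y, 0))).2 = 0)
    (hlim : ∃ k₀, ∀ k ≥ k₀, ∀ y ∈ closedBall c a₁, ‖F^[k] (Φ (y, 0))‖ < a)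
    {ε : ℝ} (hε : 0 < ε) :
    ∃ n, ∀ m ≥ n, ∀ η : Z → Y, ContDiffOn ℝ 1 η (closedBall 0 b₁) →
      (∀ z ∈ closedBall (0 : Z) b₁, η z ∈ closedBall c a₁) →
      (∀ z ∈ closedBall (0 : Z) b₁, ∀ z' ∈ closedBall (0 : Z) b₁, ‖η z - η z'‖ ≤ ‖z - z'‖) →
      ∃ h : Z → Y × Z, ContDiffOn ℝ 1 h (ball 0 δ) ∧ ∀ ζ ∈ ball (0 : Z) δ,
        (h ζ).2 = ζ ∧ ‖(h ζ).1‖ ≤ ε ∧ (∃ z ∈ closedBall (0 : Z) b₁, F^[m] (Φ (η z, z)) = h ζ) ∧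
        ∀ ζ' ∈ ball (0 : Z) δ, ‖(h ζ).1 - (h ζ').1‖ ≤ ε * ‖ζ - ζ'‖ := by
  obtain ⟨k, r, q, hr, hrb, hq, H⟩ :=
    exists_iterate_cone hFc hFinj hF hb.le hT hΦ hΦinj ha₁ hb₁ hbox hz hlim
  obtain ⟨n, hn⟩ := hF.exists_graph_subset_iterate hFc hb hδ hin hexit hr hq hε
  refine ⟨n + k, fun m hm η hηc hηb hηl => ?_⟩
  have hsub : closedBall (0 : Z) r ⊆ closedBall 0 b₁ := closedBall_subset_closedBall hrb
  have hmaps : ∀ z ∈ closedBall (0 : Z) r, (η z, z) ∈ T := fun z hz =>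
    hbox ⟨hηb z (hsub hz), hsub hz⟩
  obtain ⟨h, hh, Hh⟩ := hn (m - k) (by omega) (fun z => F^[k] (Φ (η z, z)))
    ((hFc.continuous.iterate k).comp_continuousOn (hΦ.continuousOn.comp
      ((hηc.continuousOn.mono hsub).prodMk continuousOn_id) hmaps))
    (fun z hz => by
      have h1 : closedBall (0 : Z) b₁ ∈ 𝓝 z := mem_of_superset (isOpen_ball.mem_nhds hz)
        (ball_subset_closedBall.trans hsub)
      have hzc := ball_subset_closedBall hz
      have h2 : ContDiffAt ℝ 1 (fun z => (η z, z)) z :=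
        ((hηc z (hsub hzc)).contDiffAt h1).prodMk contDiffAt_id
      have h3 : ContDiffAt ℝ 1 Φ (η z, z) :=
        (hΦ _ (hmaps z hzc)).contDiffAt (hT.mem_nhds (hmaps z hzc))
      exact (contDiff_iterate hFc k).contDiffAt.comp z (ContDiffAt.comp (f := fun z => (η z, z)) z h3 h2))
    (hz k _ (hηb 0 (by simpa using hb₁.le)))
    (H η (fun z hz => hηb z (hsub hz)) (fun z hz z' hz' => hηl z (hsub hz) z' (hsub hz')))
  refine ⟨h, hh, fun ζ hζ => ?_⟩
  obtain ⟨h1, h2, ⟨z, hz1, hz2⟩, h4⟩ := Hh ζ hζ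
  refine ⟨h1, h2, ⟨z, hsub hz1, ?_⟩, h4⟩
  rwa [← Function.iterate_add_apply, Nat.sub_add_cancel (by omega)] at hz2

end Graphs

/-- The derivative of a map with a differentiable left inverse is injective. -/
theorem injective_fderiv_of_leftInverse {X W : Type*} [NormedAddCommGroup X] [NormedSpace ℝ X]
    [NormedAddCommGroup W] [NormedSpace ℝ W] {f : X → W} {g : W → X} {x : X}
    (hf : DifferentiableAt ℝ f x) (hg : DifferentiableAt ℝ g (f x))
    (h : ∀ᶠ x' in 𝓝 x, g (f x') = x') : Function.Injective (fderiv ℝ f x) := by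
  have h1 := hg.hasFDerivAt.comp x hf.hasFDerivAt
  have h2 := h1.unique ((hasFDerivAt_id x).congr_of_eventuallyEq h)
  exact Function.LeftInverse.injective (g := fderiv ℝ g (f x)) fun v => by
    simpa using congrArg (fun S => S v) h2

/-! ### From graphs of small slope to embedded disks close to the identity -/

section Disks

variable {s u : ℕ}

theorem uniqueDiffOn_closedBall {δ : ℝ} (hδ : 0 < δ) :
    UniqueDiffOn ℝ (closedBall (0 : Euc u) δ) :=
  uniqueDiffOn_convex (convex_closedBall _ _)
    ⟨0, by rw [interior_closedBall _ hδ.ne']; exact mem_ball_self hδ⟩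

theorem IsAdmissibleMap.norm_sub_le_norm_sub {c : Euc s} {a b : ℝ} {η : Euc u → Euc s}
    (h : IsAdmissibleMap c a b η) {z z' : Euc u} (hz : z ∈ closedBall (0 : Euc u) b)
    (hz' : z' ∈ closedBall (0 : Euc u) b) : ‖η z - η z'‖ ≤ ‖z - z'‖ := by
  have := (convex_closedBall (0 : Euc u) b).norm_image_sub_le_of_norm_fderivWithin_le
    (h.contDiffOn.differentiableOn one_ne_zero) h.norm_fderivWithin_le hz' hz
  simpa using this

/-- A `C^1` graph over a ball with small height and small slopes is an embedded disk close to the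
central disk. -/
theorem isDiskEmbedding_and_distOneIdLT {δ δ' ε ε' : ℝ} (hδ : 0 < δ) (hδ' : δ < δ') (hε' : 0 < ε')
    (hε : ε' + ε' < ε) {h : Euc u → Phase s u} (hc : ContDiffOn ℝ 1 h (ball 0 δ'))
    (H : ∀ ζ ∈ ball (0 : Euc u) δ', (h ζ).2 = ζ ∧ ‖(h ζ).1‖ ≤ ε' ∧
      ∀ ζ' ∈ ball (0 : Euc u) δ', ‖(h ζ).1 - (h ζ').1‖ ≤ ε' * ‖ζ - ζ'‖) :
    IsDiskEmbedding δ h ∧ DistOneIdLT δ h ε := by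
  have hsub : closedBall (0 : Euc u) δ ⊆ ball 0 δ' := closedBall_subset_ball hδ'
  have hd : ∀ z ∈ closedBall (0 : Euc u) δ, HasFDerivAt h (fderivWithin ℝ h (closedBall 0 δ) z) z := by
    intro z hz
    have h1 : DifferentiableAt ℝ h z := ((hc.differentiableOn one_ne_zero) z (hsub hz)).differentiableAt
      (isOpen_ball.mem_nhds (hsub hz))
    rw [h1.fderivWithin (uniqueDiffOn_closedBall hδ z hz)]
    exact h1.hasFDerivAt
  -- On a graph `h - id` is `((h ζ).1, 0)`, so a Lipschitz bound on the height bounds `D(h - id)`.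
  have hg : ∀ z ∈ closedBall (0 : Euc u) δ, HasFDerivAt (fun ζ => ((h ζ).1, (0 : Euc u)))
      (fderivWithin ℝ h (closedBall 0 δ) z - ContinuousLinearMap.inr ℝ (Euc s) (Euc u)) z := by
    intro z hz
    refine ((hd z hz).sub (ContinuousLinearMap.inr ℝ (Euc s) (Euc u)).hasFDerivAt).congr_of_eventuallyEq ?_
    filter_upwards [isOpen_ball.mem_nhds (hsub hz)] with ζ hζ
    refine Prod.ext (by simp) ?_
    simp [(H ζ hζ).1]
  have hsnd : ∀ z ∈ closedBall (0 : Euc u) δ, ∀ w,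
      (fderivWithin ℝ h (closedBall 0 δ) z w).2 = w := by
    intro z hz w
    have h1 : HasFDerivAt (fun ζ => (h ζ).2) _ z := hasFDerivAt_snd.comp z (hd z hz)
    have h2 : HasFDerivAt (fun ζ => (h ζ).2) (ContinuousLinearMap.id ℝ (Euc u)) z :=
      (hasFDerivAt_id z).congr_of_eventuallyEq (by
        filter_upwards [isOpen_ball.mem_nhds (hsub hz)] with ζ hζ using (H ζ hζ).1)
    simpa using congrArg (fun S => S w) (h1.unique h2)
  refine ⟨⟨hc.mono hsub, fun z hz z' hz' he => ?_, fun z hz w w' hw => ?_⟩,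
    ε', ε', hε, fun z hz => ⟨?_, ?_⟩⟩
  · rw [← (H z (hsub hz)).1, ← (H z' (hsub hz')).1, he]
  · rw [← hsnd z hz w, ← hsnd z hz w', hw]
  · obtain ⟨h1, h2, -⟩ := H z (hsub hz)
    have : h z - (0, z) = ((h z).1, 0) := Prod.ext (by simp) (by simp [h1])
    rw [this, Prod.norm_mk, norm_zero, max_eq_left (norm_nonneg _)]
    exact h2
  · refine (hg z hz).le_of_lip' hε'.le ?_
    filter_upwards [isOpen_ball.mem_nhds (hsub hz)] with ζ hζ
    rw [Prod.mk_sub_mk, sub_zero, Prod.norm_mk, norm_zero, max_eq_left (norm_nonneg _)]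
    exact (H ζ hζ).2.2 z (hsub hz)

end Disks

/-! ### Consequences of the hypotheses on `F` and its local manifolds -/

variable {s u : ℕ}

theorem IsLocalStableManifold.tendsto_iterate {F : Phase s u ≃ Phase s u} {W : Set (Phase s u)}
    (h : IsLocalStableManifold F W) {x : Phase s u} (hx : x ∈ W) :
    Tendsto (fun m : ℕ => F^[m] x) atTop (𝓝 0) := by
  obtain ⟨-, -, ρ, hρ, hρ1, H⟩ := h
  refine squeeze_zero_norm (fun m => ?_) (H x hx)
  refine le_mul_of_one_le_right (norm_nonneg _) ?_
  exact (one_le_inv₀ (pow_pos hρ m)).2 (pow_le_one₀ hρ.le hρ1.le)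

theorem IsAdaptedDiffeo.injective_fderiv {F : Phase s u ≃ Phase s u} {B : Euc s →L[ℝ] Euc s}
    {C : Euc u ≃L[ℝ] Euc u} (hF : IsAdaptedDiffeo F B C) (x : Phase s u) :
    Function.Injective (fderiv ℝ F x) :=
  injective_fderiv_of_leftInverse (hF.contDiff.differentiable one_ne_zero x)
    (hF.contDiff_symm.differentiable one_ne_zero _) (Eventually.of_forall F.symm_apply_apply)

theorem IsStraighteningChart.injective_fderiv_symm {Ws : Set (Phase s u)} {p : Phase s u}
    {Ψ : OpenPartialHomeomorph (Phase s u) (Phase s u)} (h : IsStraighteningChart Ws p Ψ)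
    {x : Phase s u} (hx : x ∈ Ψ.target) : Function.Injective (fderiv ℝ Ψ.symm x) := by
  have hx' := Ψ.map_target hx
  refine injective_fderiv_of_leftInverse (g := Ψ)
    (((h.contDiffOn_symm x hx).contDiffAt (Ψ.open_target.mem_nhds hx)).differentiableAt one_ne_zero)
    (((h.contDiffOn _ hx').contDiffAt (Ψ.open_source.mem_nhds hx')).differentiableAt one_ne_zero) ?_
  filter_upwards [Ψ.open_target.mem_nhds hx] with y hy using Ψ.right_inv hy

theorem box_eq (c : Euc s) (a b : ℝ) :
    (box c a b : Set (Phase s u)) = closedBall c a ×ˢ closedBall (0 : Euc u) b := by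
  ext x
  simp [box, mem_prod, dist_eq_norm]

/-- The local manifolds supply the invariance of both coordinate spaces near `0`. For `Wcu` it is
only local, so continuity of `F` at `0` is used to keep the image in the neighbourhood `O`. -/
theorem isConeContraction_of_isAdaptedDiffeo {F : Phase s u ≃ Phase s u}
    {B : Euc s →L[ℝ] Euc s} {C : Euc u ≃L[ℝ] Euc u} (hF : IsAdaptedDiffeo F B C)
    {Ws Wcu : Set (Phase s u)} (hs : MapsTo F Ws Ws) (hcu : IsLocalCenterUnstableManifold F Wcu)
    (hWs : ∀ x ∈ Ws, x.2 = 0) (hWcu : ∀ x ∈ Wcu, x.1 = 0) {a b : ℝ} (ha : 0 < a) (hb : 0 < b)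
    (hWs₀ : ∀ x ∈ closedBall (0 : Euc s) a ×ˢ closedBall (0 : Euc u) b, x ∈ Ws ↔ x.2 = 0)
    (hWcu₀ : ∀ x ∈ closedBall (0 : Euc s) a ×ˢ closedBall (0 : Euc u) b, x ∈ Wcu ↔ x.1 = 0) :
    ∃ lam κ ω R : ℝ, 0 < R ∧ ∀ b < R, ∃ a₀ > 0, ∀ a ≤ a₀,
      IsConeContraction (F : Phase s u → Phase s u) lam κ ω a b := by
  refine exists_isConeContraction hF.contDiff hF.hasFDerivAt_zero hF.norm_lt_one
    hF.norm_mul_lt_one ?_ ?_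
  · filter_upwards [closedBall_mem_nhds (0 : Euc s) ha] with y hy
    exact hWs _ (hs ((hWs₀ (y, 0) ⟨hy, by simpa using hb.le⟩).2 rfl))
  · obtain ⟨-, O, hO, HO⟩ := hcu
    have hc : Continuous fun z : Euc u => ((0 : Euc s), z) := by fun_prop
    have h1 : ∀ᶠ z in 𝓝 (0 : Euc u), ((0 : Euc s), z) ∈ O := hc.continuousAt.eventually_mem hO
    have h2 : ∀ᶠ z in 𝓝 (0 : Euc u), F ((0 : Euc s), z) ∈ O := by
      refine (hF.contDiff.continuous.comp hc).continuousAt.eventually_mem ?_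
      change O ∈ 𝓝 (F 0)
      rwa [hF.map_zero]
    filter_upwards [h1, h2, closedBall_mem_nhds (0 : Euc u) hb] with z hz1 hz2 hz3
    exact hWcu _ ((HO _ ⟨(hWcu₀ (0, z) ⟨by simpa using ha.le, hz3⟩).2 rfl, hz1⟩).1 hz2)

/-- Points of the local stable manifold that are close to the fixed point remain close to it. -/
theorem IsConeContraction.norm_iterate_lt_of_mem {F : Phase s u → Phase s u} {lam κ ω a b : ℝ}
    (hF : IsConeContraction F lam κ ω a b) (hb : 0 ≤ b) {Ws : Set (Phase s u)}
    (hs : MapsTo F Ws Ws) (hWs : ∀ x ∈ Ws, x.2 = 0) {ε : ℝ} (hεa : ε ≤ a) {x : Phase s u}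
    (hx : x ∈ Ws) (hxε : ‖x‖ < ε) (k : ℕ) : ‖F^[k] x‖ < ε := by
  induction k with
  | zero => exact hxε
  | succ k ih =>
    have h1 := hWs _ (hs.iterate k hx)
    have h2 := hWs _ (hs.iterate (k + 1) hx)
    have h3 : ‖(F^[k] x).1‖ < ε := (_root_.norm_fst_le _).trans_lt ih
    have h4 := hF.norm_fst_le (F^[k] x)
      ⟨by simpa using (h3.le.trans hεa), by rw [h1]; simpa using hb⟩
    rw [← Function.iterate_succ_apply' F k x] at h4
    rw [Prod.norm_def, h2, norm_zero, max_eq_left (norm_nonneg _)]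
    exact (h4.trans (mul_le_of_le_one_left (norm_nonneg _) hF.lam_lt_one.le)).trans_lt h3

end NonhypLambda

/-! ### The nonhyperbolic λ-lemma -/

open NonhypLambda in
theorem lemma2p1 {s u : ℕ}
    (F : NonhypLambda.Phase s u ≃ NonhypLambda.Phase s u)
    (B : NonhypLambda.Euc s →L[ℝ] NonhypLambda.Euc s)
    (C : NonhypLambda.Euc u ≃L[ℝ] NonhypLambda.Euc u)
    (hF : NonhypLambda.IsAdaptedDiffeo F B C)
    (Ws Wcu : Set (NonhypLambda.Phase s u))
    (hSCU : NonhypLambda.IsStronglyConditionallyUnstable F Ws Wcu)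
    -- the local manifolds are straightened
    (hWs : ∀ x ∈ Ws, x.2 = 0) (hWcu : ∀ x ∈ Wcu, x.1 = 0)
    -- the box around the origin
    (εy₀ εz₀ : ℝ) (hεy₀ : 0 < εy₀) (hεz₀ : 0 < εz₀)
    (hWs₀ : ∀ x ∈ NonhypLambda.box (s := s) (u := u) 0 εy₀ εz₀, x ∈ Ws ↔ x.2 = 0)
    (hWcu₀ : ∀ x ∈ NonhypLambda.box (s := s) (u := u) 0 εy₀ εz₀, x ∈ Wcu ↔ x.1 = 0)
    -- the box around a point `p` of the local stable manifold, in local coordinates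
    (p : NonhypLambda.Phase s u) (hp : p ∈ Ws)
    (Ψ : OpenPartialHomeomorph (NonhypLambda.Phase s u) (NonhypLambda.Phase s u))
    (hΨ : NonhypLambda.IsStraighteningChart Ws p Ψ)
    (εy₁ εz₁ : ℝ) (hεy₁ : 0 < εy₁) (hεz₁ : 0 < εz₁)
    (hbox₁ : NonhypLambda.box p.1 εy₁ εz₁ ⊆ Ψ.target) :
    ∃ δ > 0, NonhypLambda.centralDisk s u δ ⊆ Wcu ∧
      ∀ ε > 0, ∃ m₀ : ℕ, ∀ m ≥ m₀,
        ∀ D ∈ NonhypLambda.admissibleDisksAtZero εy₀ εz₀ ∪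
            NonhypLambda.admissibleDisksAt p Ψ εy₁ εz₁,
          ∃ h : NonhypLambda.Euc u → NonhypLambda.Phase s u,
            NonhypLambda.IsDiskEmbedding δ h ∧
            h '' Metric.closedBall 0 δ ⊆ F^[m] '' D ∧
            NonhypLambda.DistOneIdLT δ h ε := by
  rw [box_eq] at hWs₀ hWcu₀ hbox₁
  obtain ⟨hst, hcu, ⟨U, hU, V, hVc, hV0, hV1, hV2⟩, ⟨hlyap, δA, hδA, hattr⟩⟩ := hSCU
  have hmaps : MapsTo F Ws Ws := hst.2.1
  have hFc := hF.contDiff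
  have hHc : Continuous F.symm := hF.contDiff_symm.continuous
  have hinv : Function.LeftInverse F.symm F := F.symm_apply_apply
  -- the box in which the dynamics are controlled
  obtain ⟨lam, κ, ω, R, hR, hcone⟩ :=
    isConeContraction_of_isAdaptedDiffeo hF hmaps hcu hWs hWcu hεy₀ hεz₀ hWs₀ hWcu₀
  obtain ⟨R', hR', hUR⟩ := Metric.nhds_basis_closedBall.mem_iff.1 hU
  obtain ⟨b, hb, hbR, hbR', hbε⟩ : ∃ b > 0, b < R ∧ b ≤ R' ∧ b ≤ εz₀ :=
    ⟨min (R / 2) (min R' εz₀), by positivity, (min_le_left _ _).trans_lt (by linarith),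
      (min_le_right _ _).trans (min_le_left _ _), (min_le_right _ _).trans (min_le_right _ _)⟩
  obtain ⟨a₀, ha₀, hcone⟩ := hcone b hbR
  -- the size of the central disk
  obtain ⟨δL, hδL, hlyapb⟩ := hlyap b hb
  obtain ⟨δ, hδ, hδL', hδA', hδε⟩ : ∃ δ > 0, δ < δL ∧ δ < δA ∧ δ ≤ εz₀ :=
    ⟨min (δL / 2) (min (δA / 2) εz₀), by positivity, (min_le_left _ _).trans_lt (by linarith),
      ((min_le_right _ _).trans (min_le_left _ _)).trans_lt (by linarith),
      (min_le_right _ _).trans (min_le_right _ _)⟩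
  have hdiskW : ∀ z ∈ closedBall (0 : Euc u) δ, ((0 : Euc s), z) ∈ Wcu := fun z hz =>
    (hWcu₀ (0, z) ⟨by simpa using hεy₀.le, closedBall_subset_closedBall hδε hz⟩).2 rfl
  have hdiskn : ∀ z ∈ closedBall (0 : Euc u) δ, ‖((0 : Euc s), z)‖ ≤ δ := fun z hz => by
    rw [Prod.norm_mk, norm_zero, max_eq_right (norm_nonneg _)]
    simpa using hz
  have hback : ∀ z ∈ closedBall (0 : Euc u) δ, ∀ k : ℕ,
      F.symm^[k] (0, z) ∈ Wcu ∧ ‖F.symm^[k] ((0 : Euc s), z)‖ < b := fun z hz =>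
    hlyapb _ (hdiskW z hz) ((hdiskn z hz).trans_lt hδL')
  have hatt : ∀ τ > 0, ∃ M : ℕ, ∀ k ≥ M, ∀ z ∈ closedBall (0 : Euc u) δ,
      ‖F.symm^[k] ((0 : Euc s), z)‖ < τ := by
    intro τ hτ
    obtain ⟨M, hM⟩ := exists_forall_norm_iterate_lt hHc (W := Wcu)
      (K := (fun z => ((0 : Euc s), z)) '' closedBall (0 : Euc u) δ)
      (fun ε hε => by
        obtain ⟨d, hd, H⟩ := hlyap ε hε
        exact ⟨d, hd, fun x hx hxd k => (H x hx hxd k).2⟩)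
      ((isCompact_closedBall _ _).image (by fun_prop))
      (by rintro _ ⟨z, hz, rfl⟩ k; exact (hback z hz k).1)
      (by rintro _ ⟨z, hz, rfl⟩; exact hattr _ (hdiskW z hz) ((hdiskn z hz).trans_lt hδA'))
      hτ
    exact ⟨M, fun k hk z hz => hM k hk _ ⟨z, hz, rfl⟩⟩
  obtain ⟨M, hM⟩ := hatt δ hδ
  -- `M + 1` replaces `M` to guarantee at least one step.
  obtain ⟨aI, haI, hI⟩ := exists_forall_norm_snd_iterate_lt (X := Euc s) hHc hinv
    (δ := δ) (b := b) (M := M + 1) (by omega) (fun k z hz => (hback z hz k).2)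
    (hM (M + 1) (by omega))
  -- The width `a` comes last: both the cone estimates and the tube around the central disk require
  -- it small relative to `b` and `δ`.
  obtain ⟨a, ha, haa₀, haI', haR', haε⟩ : ∃ a > 0, a ≤ a₀ ∧ a ≤ aI ∧ a ≤ R' ∧ a ≤ εy₀ :=
    ⟨min (min a₀ aI) (min R' εy₀), by positivity, (min_le_left _ _).trans (min_le_left _ _),
      (min_le_left _ _).trans (min_le_right _ _), (min_le_right _ _).trans (min_le_left _ _),
      (min_le_right _ _).trans (min_le_right _ _)⟩
  have hC := hcone a haa₀
  set Q := closedBall (0 : Euc s) a ×ˢ closedBall (0 : Euc u) b with hQ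
  have hQU : Q ⊆ U := by
    rintro ⟨y, z⟩ ⟨hy, hz⟩
    refine hUR ?_
    simp only [mem_closedBall, dist_zero_right] at hy hz
    rw [mem_closedBall, dist_zero_right, Prod.norm_mk]
    exact max_le (hy.trans haR') (hz.trans hbR')
  have hQ₀ : Q ⊆ closedBall (0 : Euc s) εy₀ ×ˢ closedBall (0 : Euc u) εz₀ :=
    prod_mono (closedBall_subset_closedBall haε) (closedBall_subset_closedBall hbε)
  have hin : ∀ m x, (∀ j ≤ m, F^[j] x ∈ Q) → ‖(F^[m] x).2‖ ≤ δ → ∀ j ≤ m, ‖(F^[j] x).2‖ < b :=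
    fun m x hx => hI m x fun j hj => (by simpa using (hx j hj).1 : ‖(F^[j] x).1‖ ≤ a).trans haI'
  have hexit : ∀ r > 0, ∃ n, ∀ m ≥ n, ∀ x : Phase s u, (∀ j ≤ m, F^[j] x ∈ Q) →
      ‖(F^[m] x).2‖ ≤ δ → ‖x.2‖ < r := fun r hr =>
    hC.exists_norm_snd_lt_of_iterate_mem hHc hinv
      (fun τ hτ => (hatt τ hτ).imp fun M h => h M le_rfl)
      (hVc.mono hQU) (fun x hx => hV0 x (hQU hx))
      (fun x hx => (hV1 x (hQU hx)).trans (hWs₀ x (hQ₀ hx)))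
      (fun x hx hFx => hV2 x ⟨hQU hx, hQU hFx⟩) hr
  -- one family of disks
  have family : ∀ (Φ : Phase s u → Phase s u) (T : Set (Phase s u)), IsOpen T →
      ContDiffOn ℝ 1 Φ T → (∀ x ∈ T, Function.Injective (fderiv ℝ Φ x)) →
      ∀ (c : Euc s) (a₁ b₁ : ℝ), 0 < a₁ → 0 < b₁ →
      closedBall c a₁ ×ˢ closedBall (0 : Euc u) b₁ ⊆ T →
      (∀ y ∈ closedBall c a₁, Φ (y, 0) ∈ Ws) → ∀ ε > 0,
      -- The graphs are `C^1` over the open ball of radius `δ`; halving the radius gives a closed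
      -- disk inside it.
      ∃ n, ∀ m ≥ n, ∀ η : Euc u → Euc s, IsAdmissibleMap c a₁ b₁ η →
        ∃ h : Euc u → Phase s u, IsDiskEmbedding (δ / 2) h ∧
          h '' closedBall 0 (δ / 2) ⊆ F^[m] '' ((fun z => Φ (η z, z)) '' closedBall 0 b₁) ∧
          DistOneIdLT (δ / 2) h ε := by
    intro Φ T hT hΦ hΦinj c a₁ b₁ ha₁ hb₁ hbox hΦW ε hε
    have hKT : ∀ y ∈ closedBall c a₁, (y, (0 : Euc u)) ∈ T := fun y hy =>
      hbox ⟨hy, by simpa using hb₁.le⟩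
    obtain ⟨n, hn⟩ := hC.exists_graph_subset_iterate_of_chart hFc hF.injective_fderiv hb hδ hin
      hexit hT hΦ hΦinj ha₁ hb₁ hbox
      (fun k y hy => hWs _ (hmaps.iterate k (hΦW y hy)))
      (by
        -- Decay on `Ws` is assumed only pointwise; stability within `Ws`, from the contraction of
        -- `y`, makes it uniform on the compact slice `z' = 0` of the box.
        obtain ⟨k₀, hk₀⟩ := exists_forall_norm_iterate_lt hFc.continuous (W := Ws)
          (K := (fun y => Φ (y, 0)) '' closedBall c a₁)
          (fun ε hε => ⟨min ε a, by positivity, fun x hx hxd k =>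
            (hC.norm_iterate_lt_of_mem hb.le hmaps hWs (min_le_right ε a) hx hxd k).trans_le
              (min_le_left _ _)⟩)
          ((isCompact_closedBall _ _).image_of_continuousOn (hΦ.continuousOn.comp
            (Continuous.prodMk_left 0).continuousOn hKT))
          (by rintro _ ⟨y, hy, rfl⟩ k; exact hmaps.iterate k (hΦW y hy))
          (by rintro _ ⟨y, hy, rfl⟩; exact hst.tendsto_iterate (hΦW y hy)) ha
        exact ⟨k₀, fun k hk y hy => hk₀ k hk _ ⟨y, hy, rfl⟩⟩)
      (ε := ε / 3) (by positivity)
    refine ⟨n, fun m hm η hη => ?_⟩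
    obtain ⟨h, hh, H⟩ := hn m hm η hη.contDiffOn
      (fun z hz => by rw [mem_closedBall, dist_eq_norm]; exact hη.norm_sub_le z hz)
      (fun z hz z' hz' => hη.norm_sub_le_norm_sub hz hz')
    obtain ⟨h1, h2⟩ := isDiskEmbedding_and_distOneIdLT (ε := ε) (half_pos hδ) (half_lt_self hδ)
      (by positivity : 0 < ε / 3) (by linarith) hh
      (fun ζ hζ => ⟨(H ζ hζ).1, (H ζ hζ).2.1, (H ζ hζ).2.2.2⟩)
    refine ⟨h, h1, ?_, h2⟩
    rintro _ ⟨ζ, hζ, rfl⟩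
    obtain ⟨z, hz, he⟩ := (H ζ (closedBall_subset_ball (half_lt_self hδ) hζ)).2.2.1
    exact ⟨_, ⟨z, hz, rfl⟩, he⟩
  refine ⟨δ / 2, half_pos hδ, ?_, fun ε hε => ?_⟩
  · rintro _ ⟨z, hz, rfl⟩
    exact hdiskW z (closedBall_subset_closedBall (half_le_self hδ.le) hz)
  -- The box at the origin may exceed the controlled box, so its disks pass through the same
  -- argument, with the identity as chart.
  · obtain ⟨n₀, hn₀⟩ := family id univ isOpen_univ contDiffOn_id
      (fun x _ => by simpa using Function.injective_id) 0 εy₀ εz₀ hεy₀ hεz₀ (subset_univ _)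
      (fun y hy => (hWs₀ (y, 0) ⟨hy, by simpa using hεz₀.le⟩).2 rfl) ε hε
    obtain ⟨n₁, hn₁⟩ := family Ψ.symm Ψ.target Ψ.open_target hΨ.contDiffOn_symm
      (fun x hx => hΨ.injective_fderiv_symm hx) p.1 εy₁ εz₁ hεy₁ hεz₁ hbox₁
      (fun y hy => by
        have hy' : (y, (0 : Euc u)) ∈ Ψ.target := hbox₁ ⟨hy, by simpa using hεz₁.le⟩
        rw [hΨ.mem_iff _ (Ψ.map_target hy'), Ψ.right_inv hy']) ε hε
    refine ⟨max n₀ n₁, fun m hm D hD => ?_⟩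
    rcases hD with ⟨η, hη, rfl⟩ | ⟨η, hη, rfl⟩
    · exact hn₀ m ((le_max_left _ _).trans hm) η hη
    · exact hn₁ m ((le_max_right _ _).trans hm) η hη
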